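/- Let $\Lambda$ be an artin algebra, i.e. an algebra over a commutative artinian ring $k$ that is finitely generated as a $k$-module. All modules are left $\Lambda$-modules. Let $\omega$ be a dualizing $\Lambda$-bimodule (so that $\Lambda$ is a Cohen–Macaulay artin algebra): $\omega$ is a finitely generated $\Lambda$-bimodule such that the adjoint pair $(\omega\otimes_\Lambda-,\ \mathrm{Hom}_\Lambda(\omega,-))$ induces inverse equivalences between the category of finitely generated $\Lambda$-modules of finite projective dimension and the category of finitely generated $\Lambda$-modules of finite injective dimension, with $\mathrm{Hom}_\Lambda(\omega,-)$ going from finite injective to finite projective dimension and $\omega\otimes_\Lambda-$ going back. Let $\mathrm{Add}\,\omega$ be the class of all modules isomorphic to direct summands of (arbitrary) direct sums of copies of $\omega$. A $\Lambda$-module $M$, not necessarily finitely generated, is called $\omega$-Gorenstein projective if there is an exact sequence $0\to M\to w_0\to w_1\to\cdots$ with all $w_i\in\mathrm{Add}\,\omega$. A finitely generated $\omega$-Gorenstein projective module is called a Cohen–Macaulay ($\mathsf{CM}$) module. The $\mathsf{CM}$-support of $M$ is the class of all indecomposable $\mathsf{CM}$ modules $N$ with $\mathrm{Hom}_\Lambda(N,M)\neq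 0$; it is of bounded length if there is an integer $b$ such that every module in it has length at most $b$. **Theorem 7.4.** Let $M$ be an $\omega$-Gorenstein projective $\Lambda$-module. If the $\mathsf{CM}$-support of $M$ is of bounded length, then $M$ is fully decomposable, i.e. $M$ is isomorphic to a (possibly infinite) direct sum of indecomposable $\mathsf{CM}$ modules. -/

import Mathlib

open CategoryTheory
open scoped TensorProduct DirectSum

universe u

namespace CMArtin

section Bimodule

variable (Λ : Type u) [Ring Λ]
variable (ω : Type u) [AddCommGroup ω] [Module Λ ω] [Module Λᵐᵒᵖ ω] [SMulCommClass Λ Λᵐᵒᵖ ω]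
variable (X : Type u) [AddCommGroup X] [Module Λ X]

/-- For a bimodule `ω` (the right action is the action of `Λᵐᵒᵖ`, so `w a` is `op a • w`) and a left
module `X`: the left submodule of `ω ⊗[ℤ] X` generated by the elements `w a ⊗ x - w ⊗ a x`. Since
the left and the right action commute, it is the additive subgroup generated by them. -/
def balancedRel : Submodule Λ (ω ⊗[ℤ] X) :=
  Submodule.span Λ {t | ∃ (w : ω) (a : Λ) (x : X),
    t = (MulOpposite.op a • w) ⊗ₜ[ℤ] x - w ⊗ₜ[ℤ] (a • x)}

/-- The left `Λ`-module `ω ⊗_Λ X`. -/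
abbrev BTensor : Type u := (ω ⊗[ℤ] X) ⧸ balancedRel Λ ω X

/-- The pure tensor `w ⊗ x` in `ω ⊗_Λ X`. -/
def BTensor.tmul (w : ω) (x : X) : BTensor Λ ω X :=
  (balancedRel Λ ω X).mkQ (w ⊗ₜ[ℤ] x)

/-- The group `Hom_Λ(ω, X)` of homomorphisms of left `Λ`-modules. -/
def BHom : Type u := ω →ₗ[Λ] X

noncomputable instance : AddCommGroup (BHom Λ ω X) :=
  inferInstanceAs (AddCommGroup (ω →ₗ[Λ] X))

/-- `Hom_Λ(ω, X)` is a left `Λ`-module through the right action on `ω`: `(a f)(w) = f (w a)`. -/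
noncomputable instance : Module Λ (BHom Λ ω X) where
  smul a f :=
    { toFun := fun w => (show ω →ₗ[Λ] X from f) (MulOpposite.op a • w)
      map_add' := fun v w => by rw [smul_add, map_add]
      map_smul' := fun b w => by rw [← smul_comm b, map_smul, RingHom.id_apply] }
  one_smul f := LinearMap.ext fun w => by
    change (show ω →ₗ[Λ] X from f) (MulOpposite.op (1 : Λ) • w) = (show ω →ₗ[Λ] X from f) w
    rw [MulOpposite.op_one, one_smul]
  mul_smul a b f := LinearMap.ext fun w => by
    change (show ω →ₗ[Λ] X from f) (MulOpposite.op (a * b) • w) =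
      (show ω →ₗ[Λ] X from f) (MulOpposite.op b • MulOpposite.op a • w)
    rw [MulOpposite.op_mul, mul_smul]
  smul_zero _ := rfl
  smul_add _ _ _ := rfl
  add_smul a b f := LinearMap.ext fun w => by
    change (show ω →ₗ[Λ] X from f) (MulOpposite.op (a + b) • w) =
      (show ω →ₗ[Λ] X from f) (MulOpposite.op a • w) +
        (show ω →ₗ[Λ] X from f) (MulOpposite.op b • w)
    rw [MulOpposite.op_add, add_smul, map_add]
  zero_smul f := LinearMap.ext fun w => by
    change (show ω →ₗ[Λ] X from f) (MulOpposite.op (0 : Λ) • w) = 0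
    rw [MulOpposite.op_zero, zero_smul, map_zero]

/-- The unit `X → Hom_Λ(ω, ω ⊗_Λ X)`, `x ↦ (w ↦ w ⊗ x)`, of the adjunction between `ω ⊗_Λ -` and
`Hom_Λ(ω, -)`. -/
noncomputable def adjUnit : X →ₗ[Λ] BHom Λ ω (BTensor Λ ω X) where
  toFun x := (show ω →ₗ[Λ] BTensor Λ ω X from
    { toFun := fun w => BTensor.tmul Λ ω X w x
      map_add' := fun v w => by
        simp only [BTensor.tmul, TensorProduct.add_tmul, map_add]
      map_smul' := fun b w => by
        simp only [BTensor.tmul, RingHom.id_apply, ← map_smul, TensorProduct.smul_tmul'] })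
  map_add' x y := LinearMap.ext fun w => by
    change BTensor.tmul Λ ω X w (x + y) = BTensor.tmul Λ ω X w x + BTensor.tmul Λ ω X w y
    simp only [BTensor.tmul, TensorProduct.tmul_add, map_add]
  map_smul' a x := LinearMap.ext fun w => by
    change BTensor.tmul Λ ω X w (a • x) = BTensor.tmul Λ ω X (MulOpposite.op a • w) x
    symm
    exact (Submodule.Quotient.eq _).2 (Submodule.subset_span ⟨w, a, x, rfl⟩)

/-- The evaluation map `ω ⊗[ℤ] Hom_Λ(ω, X) → X`, `w ⊗ f ↦ f w`. -/
noncomputable def evalTensor : ω ⊗[ℤ] BHom Λ ω X →ₗ[Λ] X :=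
  { (TensorProduct.lift (LinearMap.mk₂ ℤ
        (fun (w : ω) (f : BHom Λ ω X) => (show ω →ₗ[Λ] X from f) w)
        (fun v w f => map_add (show ω →ₗ[Λ] X from f) v w)
        (fun n w f => map_zsmul (show ω →ₗ[Λ] X from f) n w)
        (fun _ _ _ => rfl)
        (fun n w f => LinearMap.smul_apply n (show ω →ₗ[Λ] X from f) w)) :
        ω ⊗[ℤ] BHom Λ ω X →ₗ[ℤ] X) with
    map_smul' := fun a t => by
      induction t with
      | zero => simp
      | add s t hs ht =>
        simp only [smul_add, AddHom.toFun_eq_coe, LinearMap.coe_toAddHom, map_add,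
          RingHom.id_apply] at hs ht ⊢
        rw [hs, ht]
      | tmul w f => exact map_smul (show ω →ₗ[Λ] X from f) a w }

/-- The counit `ω ⊗_Λ Hom_Λ(ω, X) → X`, `w ⊗ f ↦ f w`, of the adjunction between `ω ⊗_Λ -` and
`Hom_Λ(ω, -)`. -/
noncomputable def adjCounit : BTensor Λ ω (BHom Λ ω X) →ₗ[Λ] X :=
  (balancedRel Λ ω (BHom Λ ω X)).liftQ (evalTensor Λ ω X) (by
    refine Submodule.span_le.2 ?_
    rintro _ ⟨w, a, f, rfl⟩
    rw [SetLike.mem_coe, LinearMap.mem_ker, map_sub]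
    exact sub_self ((show ω →ₗ[Λ] X from f) (MulOpposite.op a • w)))

end Bimodule

section Dualizing

variable (Λ : Type u) [Ring Λ]

/-- Finitely generated modules of finite projective dimension. -/
def InPInfty (X : Type u) [AddCommGroup X] [Module Λ X] : Prop :=
  Module.Finite Λ X ∧ ∃ n : ℕ, HasProjectiveDimensionLE (ModuleCat.of Λ X) n

/-- Finitely generated modules of finite injective dimension. -/
def InIInfty (X : Type u) [AddCommGroup X] [Module Λ X] : Prop :=
  Module.Finite Λ X ∧ ∃ n : ℕ, HasInjectiveDimensionLE (ModuleCat.of Λ X) n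

/-- A bimodule `ω`, finitely generated as a left module, is dualizing for `Λ` if the adjoint pair
`(ω ⊗_Λ -, Hom_Λ(ω, -))` induces inverse equivalences between the finitely generated
modules of finite projective dimension and those of finite injective dimension: the two functors
interchange the two classes, and on these the unit and the counit are isomorphisms. -/
structure IsDualizing (ω : Type u) [AddCommGroup ω] [Module Λ ω] [Module Λᵐᵒᵖ ω]
    [SMulCommClass Λ Λᵐᵒᵖ ω] : Prop where
  finite : Module.Finite Λ ω
  tensor_mem : ∀ (X : Type u) [AddCommGroup X] [Module Λ X],
    InPInfty Λ X → InIInfty Λ (BTensor Λ ω X)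
  hom_mem : ∀ (Y : Type u) [AddCommGroup Y] [Module Λ Y],
    InIInfty Λ Y → InPInfty Λ (BHom Λ ω Y)
  unit_bijective : ∀ (X : Type u) [AddCommGroup X] [Module Λ X],
    InPInfty Λ X → Function.Bijective (adjUnit Λ ω X)
  counit_bijective : ∀ (Y : Type u) [AddCommGroup Y] [Module Λ Y],
    InIInfty Λ Y → Function.Bijective (adjCounit Λ ω Y)

end Dualizing

section CM

variable (Λ : Type u) [Ring Λ] (ω : Type u) [AddCommGroup ω] [Module Λ ω]

/-- `W` belongs to `Add ω`: it is isomorphic to a direct summand of a (possibly infinite) direct sum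
of copies of `ω`. -/
def InAdd (W : Type u) [AddCommGroup W] [Module Λ W] : Prop :=
  ∃ (ι : Type u) (i : W →ₗ[Λ] (ι →₀ ω)) (p : (ι →₀ ω) →ₗ[Λ] W), p ∘ₗ i = LinearMap.id

/-- `M` is `ω`-Gorenstein projective: there is an exact sequence `0 → M → W₀ → W₁ → ⋯` with all
`Wᵢ` in `Add ω`. -/
def IsGorensteinProjective (M : Type u) [AddCommGroup M] [Module Λ M] : Prop :=
  ∃ (W : ℕ → ModuleCat.{u} Λ) (ε : M →ₗ[Λ] W 0) (d : ∀ i : ℕ, W i →ₗ[Λ] W (i + 1)),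
    (∀ i, InAdd Λ ω (W i)) ∧ Function.Injective ε ∧ Function.Exact ε (d 0) ∧
      ∀ i, Function.Exact (d i) (d (i + 1))

/-- An indecomposable Cohen-Macaulay module: an indecomposable finitely generated `ω`-Gorenstein
projective module. -/
def IsIndecomposableCM (N : ModuleCat.{u} Λ) : Prop :=
  Module.Finite Λ N ∧ IsGorensteinProjective Λ ω N ∧ Indecomposable N

/-- The `CM`-support of `M`: the indecomposable Cohen-Macaulay modules `N` with
`Hom_Λ(N, M) ≠ 0`. -/
def cmSupport (M : Type u) [AddCommGroup M] [Module Λ M] : Set (ModuleCat.{u} Λ) :=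
  {N | IsIndecomposableCM Λ ω N ∧ ∃ f : N →ₗ[Λ] M, f ≠ 0}

/-- A class of modules is of bounded length. -/
def IsOfBoundedLength (S : Set (ModuleCat.{u} Λ)) : Prop :=
  ∃ b : ℕ, ∀ N ∈ S, Module.length Λ N ≤ (b : ℕ∞)

/-- `M` is fully decomposable: it is a direct sum of indecomposable Cohen-Macaulay modules. -/
def IsFullyDecomposable (M : Type u) [AddCommGroup M] [Module Λ M] : Prop :=
  ∃ (ι : Type u) (N : ι → ModuleCat.{u} Λ),
    (∀ i, IsIndecomposableCM Λ ω (N i)) ∧ Nonempty (M ≃ₗ[Λ] ⨁ i, N i)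

end CM

end CMArtin

/-! The proof has a homological half and a combinatorial half.

Homological half. A finitely generated `X` with `Ext^i(X, ω) = 0` for all `i ≥ 1` is CM
(`IsDualizing.isGorensteinProjective`): it embeds into some `ω^n`, so generators of `Hom(X, ω)` give
an injective left approximation. The cokernel has the same vanishing, and the construction iterates.
Since `ω` has finite injective dimension, dimension shifting along the coresolution of `M` shows
that every map from a finitely generated module to `M` factors through such an `X`
(`exists_factorization`). Splitting `X` into indecomposables, the map factors through a finite
direct sum of modules in the CM-support.

Combinatorial half (`exists_directSum_equiv`). By the Harada-Sai lemma, long compositions of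
nonisomorphisms between indecomposables of bounded length vanish. Choose a maximal family of maps
`N_j → M` independent modulo the radical, with sum `φ : ⨁ N_j → M`. By maximality, every map from a
support module to `M` lifts along `φ` up to a radical error. Treating the errors the same way leads
to ever longer paths of nonisomorphisms, so the process stops; every map from a finitely generated
module lifts, and `φ` is onto. If `φ x = 0` with `x` in a finite subsum `D`, then `D → M` factors
through `D / (x)` and hence lifts. The inclusion of `D` minus this lift is killed by `φ`, so
independence makes its components nonisomorphisms; but it fixes `x`, and Harada-Sai forces `x = 0`.
-/

namespace CMArtin

open CategoryTheory.Abelian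

/-! ### Vanishing of Ext along retracts, short exact sequences and finite powers. -/

section Ext

variable (Λ : Type u) [Ring Λ]

/-- `Ext^i(X, Y) = 0` for all `i ≥ j`. -/
def ExtVanishes (X Y : Type u) [AddCommGroup X] [Module Λ X] [AddCommGroup Y] [Module Λ Y]
    (j : ℕ) : Prop :=
  ∀ i, j ≤ i → ∀ x : Ext (ModuleCat.of Λ X) (ModuleCat.of Λ Y) i, x = 0

variable {Λ}
variable {A B C X Y : Type u} [AddCommGroup A] [Module Λ A] [AddCommGroup B] [Module Λ B]
  [AddCommGroup C] [Module Λ C] [AddCommGroup X] [Module Λ X] [AddCommGroup Y] [Module Λ Y]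

theorem ExtVanishes.mono {i j : ℕ} (h : ExtVanishes Λ X Y i) (hij : i ≤ j) :
    ExtVanishes Λ X Y j :=
  fun k hk => h k (hij.trans hk)

/-- The short exact sequence in `ModuleCat` given by linear maps. -/
theorem exists_shortExact {f : A →ₗ[Λ] B} {g : B →ₗ[Λ] C} (hf : Function.Injective f)
    (hg : Function.Surjective g) (hfg : Function.Exact f g) :
    ∃ w, (ShortComplex.mk (ModuleCat.ofHom f) (ModuleCat.ofHom g) w).ShortExact := by
  have w : ModuleCat.ofHom f ≫ ModuleCat.ofHom g = 0 := by
    rw [← ModuleCat.ofHom_comp, hfg.linearMap_comp_eq_zero]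
    rfl
  exact ⟨w, { exact := (ShortComplex.ShortExact.moduleCat_exact_iff_function_exact _).2 hfg
              mono_f := (ModuleCat.mono_iff_injective _).2 hf
              epi_g := (ModuleCat.epi_iff_surjective _).2 hg }⟩

theorem ExtVanishes.of_retract_left {j : ℕ} (h : ExtVanishes Λ B Y j) (i : A →ₗ[Λ] B)
    (p : B →ₗ[Λ] A) (hpi : p ∘ₗ i = LinearMap.id) : ExtVanishes Λ A Y j := by
  intro n hn x
  have h1 : (Ext.mk₀ (ModuleCat.ofHom i ≫ ModuleCat.ofHom p)).comp x (zero_add n) = x := by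
    rw [← ModuleCat.ofHom_comp, hpi]
    exact Ext.mk₀_id_comp x
  rw [← h1, ← Ext.mk₀_comp_mk₀_assoc,
    h n hn ((Ext.mk₀ (ModuleCat.ofHom p)).comp x (zero_add n)), Ext.comp_zero]

theorem ExtVanishes.of_retract_right {j : ℕ} (h : ExtVanishes Λ X B j) (i : A →ₗ[Λ] B)
    (p : B →ₗ[Λ] A) (hpi : p ∘ₗ i = LinearMap.id) : ExtVanishes Λ X A j := by
  intro n hn x
  have h1 : x.comp (Ext.mk₀ (ModuleCat.ofHom i ≫ ModuleCat.ofHom p)) (add_zero n) = x := by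
    rw [← ModuleCat.ofHom_comp, hpi]
    exact Ext.comp_mk₀_id x
  rw [← h1, ← Ext.mk₀_comp_mk₀, ← Ext.comp_assoc_of_third_deg_zero,
    h n hn (x.comp (Ext.mk₀ (ModuleCat.ofHom i)) (add_zero n)), Ext.zero_comp]

section ShortExact

variable {f : A →ₗ[Λ] B} {g : B →ₗ[Λ] C} (hf : Function.Injective f)
  (hg : Function.Surjective g) (hfg : Function.Exact f g)
include hf hg hfg

theorem ExtVanishes.middle_left {j : ℕ} (hA : ExtVanishes Λ A Y j) (hC : ExtVanishes Λ C Y j) :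
    ExtVanishes Λ B Y j := by
  obtain ⟨w, hS⟩ := exists_shortExact hf hg hfg
  intro n hn x
  obtain ⟨y, rfl⟩ := Ext.contravariant_sequence_exact₂ hS _ x (hA n hn _)
  rw [hC n hn y, Ext.comp_zero]

theorem ExtVanishes.middle_right {j : ℕ} (hA : ExtVanishes Λ X A j) (hC : ExtVanishes Λ X C j) :
    ExtVanishes Λ X B j := by
  obtain ⟨w, hS⟩ := exists_shortExact hf hg hfg
  intro n hn x
  obtain ⟨y, rfl⟩ := Ext.covariant_sequence_exact₂ _ hS x (hC n hn _)
  rw [hA n hn y, Ext.zero_comp]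

theorem ExtVanishes.cokernel_right {j : ℕ} (hA : ExtVanishes Λ X A (j + 1))
    (hB : ExtVanishes Λ X B j) : ExtVanishes Λ X C j := by
  obtain ⟨w, hS⟩ := exists_shortExact hf hg hfg
  intro n hn x
  obtain ⟨y, rfl⟩ := Ext.covariant_sequence_exact₃ _ hS x rfl (hA _ (by omega) _)
  rw [hB n hn y, Ext.zero_comp]

theorem ExtVanishes.kernel_left {j : ℕ} (hC : ExtVanishes Λ C Y (j + 1))
    (hB : ExtVanishes Λ B Y j) : ExtVanishes Λ A Y j := by
  obtain ⟨w, hS⟩ := exists_shortExact hf hg hfg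
  intro n hn x
  obtain ⟨y, rfl⟩ := Ext.contravariant_sequence_exact₁ hS _ x rfl (hC _ (by omega) _)
  rw [hB n hn y, Ext.comp_zero]

/-- A degree-one class on `C` is the connecting image of a map `A → Y`, and it vanishes once that
map extends to `B`. Higher classes come from Ext groups of `A`. -/
theorem ExtVanishes.cokernel_left (hA : ExtVanishes Λ A Y 1) (hB : ExtVanishes Λ B Y 1)
    (hY : ∀ φ : A →ₗ[Λ] Y, ∃ ψ : B →ₗ[Λ] Y, ψ ∘ₗ f = φ) : ExtVanishes Λ C Y 1 := by
  obtain ⟨w, hS⟩ := exists_shortExact hf hg hfg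
  intro n hn x
  obtain ⟨m, rfl⟩ : ∃ m, n = 1 + m := ⟨n - 1, by omega⟩
  obtain ⟨y, rfl⟩ := Ext.contravariant_sequence_exact₃ hS _ x (hB _ hn _) rfl
  rcases Nat.eq_zero_or_pos m with rfl | hm
  · obtain ⟨φ, rfl⟩ := Ext.mk₀_bijective _ _ |>.2 y
    obtain ⟨ψ, hψ⟩ := hY φ.hom
    have : φ = ModuleCat.ofHom f ≫ ModuleCat.ofHom ψ := by
      rw [← ModuleCat.ofHom_comp, hψ]; rfl
    rw [this, ← Ext.mk₀_comp_mk₀, hS.extClass_comp_assoc]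
  · rw [hA m hm y, Ext.comp_zero]

theorem ExtVanishes.kernel_right (hC : ExtVanishes Λ X C 1) (hB : ExtVanishes Λ X B 1)
    (hX : ∀ φ : X →ₗ[Λ] C, ∃ ψ : X →ₗ[Λ] B, g ∘ₗ ψ = φ) : ExtVanishes Λ X A 1 := by
  obtain ⟨w, hS⟩ := exists_shortExact hf hg hfg
  intro n hn x
  obtain ⟨m, rfl⟩ : ∃ m, n = m + 1 := ⟨n - 1, by omega⟩
  obtain ⟨y, rfl⟩ := Ext.covariant_sequence_exact₁ _ hS x (hB _ hn _) rfl
  rcases Nat.eq_zero_or_pos m with rfl | hm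
  · obtain ⟨φ, rfl⟩ := Ext.mk₀_bijective _ _ |>.2 y
    obtain ⟨ψ, hψ⟩ := hX φ.hom
    have : φ = ModuleCat.ofHom ψ ≫ ModuleCat.ofHom g := by
      rw [← ModuleCat.ofHom_comp, hψ]; rfl
    rw [this, ← Ext.mk₀_comp_mk₀, Ext.comp_assoc_of_second_deg_zero, hS.comp_extClass,
      Ext.comp_zero]
  · rw [hC m hm y, Ext.zero_comp]

theorem ExtVanishes.exists_lift (hA : ExtVanishes Λ X A 1) (φ : X →ₗ[Λ] C) :
    ∃ ψ : X →ₗ[Λ] B, g ∘ₗ ψ = φ := by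
  obtain ⟨w, hS⟩ := exists_shortExact hf hg hfg
  obtain ⟨y, hy⟩ := Ext.covariant_sequence_exact₃ _ hS (Ext.mk₀ (ModuleCat.ofHom φ)) rfl
    (hA _ le_rfl _)
  obtain ⟨ψ, rfl⟩ := Ext.mk₀_bijective _ _ |>.2 y
  rw [Ext.mk₀_comp_mk₀] at hy
  have := Ext.mk₀_bijective _ _ |>.1 hy
  exact ⟨ψ.hom, congrArg ModuleCat.Hom.hom this⟩

end ShortExact

theorem ExtVanishes.of_subsingleton_left [Subsingleton X] (j : ℕ) : ExtVanishes Λ X Y j := by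
  intro n _ x
  have h0 : (𝟙 (ModuleCat.of Λ X)) = 0 := by ext x; exact Subsingleton.elim _ _
  rw [← Ext.mk₀_id_comp x, h0, Ext.mk₀_zero, Ext.zero_comp]

theorem ExtVanishes.of_subsingleton_right [Subsingleton Y] (j : ℕ) : ExtVanishes Λ X Y j := by
  intro n _ x
  have h0 : (𝟙 (ModuleCat.of Λ Y)) = 0 := by ext x; exact Subsingleton.elim _ _
  rw [← Ext.comp_mk₀_id x, h0, Ext.mk₀_zero, Ext.comp_zero]

theorem ExtVanishes.of_projective [Module.Projective Λ X] : ExtVanishes Λ X Y 1 := by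
  intro n hn x
  obtain ⟨m, rfl⟩ : ∃ m, n = m + 1 := ⟨n - 1, by omega⟩
  have := (IsProjective.iff_projective (R := Λ) X).1 inferInstance
  exact x.eq_zero_of_projective

theorem ExtVanishes.of_injective (hY : Injective (ModuleCat.of Λ Y)) : ExtVanishes Λ X Y 1 := by
  intro n hn x
  obtain ⟨m, rfl⟩ : ∃ m, n = m + 1 := ⟨n - 1, by omega⟩
  exact x.eq_zero_of_injective

theorem ExtVanishes.of_hasInjectiveDimensionLT {j : ℕ}
    (hY : HasInjectiveDimensionLT (ModuleCat.of Λ Y) j) : ExtVanishes Λ X Y j :=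
  fun _ hn x => x.eq_zero_of_hasInjectiveDimensionLT j hn

theorem ExtVanishes.prod_left {j : ℕ} (hA : ExtVanishes Λ A Y j) (hB : ExtVanishes Λ B Y j) :
    ExtVanishes Λ (A × B) Y j :=
  hA.middle_left LinearMap.inl_injective LinearMap.snd_surjective
    (LinearMap.exact_iff.2 (LinearMap.ker_snd Λ A B)) hB

theorem ExtVanishes.prod_right {j : ℕ} (hA : ExtVanishes Λ X A j) (hB : ExtVanishes Λ X B j) :
    ExtVanishes Λ X (A × B) j :=
  hA.middle_right LinearMap.inl_injective LinearMap.snd_surjective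
    (LinearMap.exact_iff.2 (LinearMap.ker_snd Λ A B)) hB

theorem ExtVanishes.pi_left {j : ℕ} (hA : ExtVanishes Λ A Y j) (n : ℕ) :
    ExtVanishes Λ (Fin n → A) Y j := by
  induction n with
  | zero => exact .of_subsingleton_left j
  | succ n ih =>
    exact (hA.prod_left ih).of_retract_left (Fin.consLinearEquiv Λ fun _ => A).symm.toLinearMap
      (Fin.consLinearEquiv Λ fun _ => A).toLinearMap (by ext1 x; simp)

theorem ExtVanishes.pi_right {j : ℕ} (hA : ExtVanishes Λ X A j) (n : ℕ) :
    ExtVanishes Λ X (Fin n → A) j := by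
  induction n with
  | zero => exact .of_subsingleton_right j
  | succ n ih =>
    exact (hA.prod_right ih).of_retract_right
      (Fin.consLinearEquiv Λ fun _ => A).symm.toLinearMap
      (Fin.consLinearEquiv Λ fun _ => A).toLinearMap (by ext1 x; simp)

end Ext

/-! ### Injective hulls of finitely generated modules over an artin algebra. -/

section InjectiveHull

variable {Λ : Type u} [Ring Λ]

/-- A module with an essential submodule `X`, in elementary terms. -/
def IsEssentialIn {J : Type*} [AddCommGroup J] [Module Λ J] (X U : Submodule Λ J) : Prop :=
  X ≤ U ∧ ∀ V ≤ U, V ⊓ X = ⊥ → V = ⊥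

/-- Precomposition as a linear map over a ring acting on the target. -/
def precomp (k : Type*) [CommRing k] [Algebra k Λ] {A B : Type*} (U : Type*) [AddCommGroup A]
    [Module Λ A] [AddCommGroup B] [Module Λ B] [AddCommGroup U] [Module Λ U] [Module k U]
    [IsScalarTower k Λ U] (g : A →ₗ[Λ] B) : (B →ₗ[Λ] U) →ₗ[k] (A →ₗ[Λ] U) where
  toFun f := f ∘ₗ g
  map_add' _ _ := rfl
  map_smul' _ _ := rfl

theorem range_precomp_mkQ (k : Type*) [CommRing k] [Algebra k Λ] {A : Type*} (U : Type*)
    [AddCommGroup A] [Module Λ A] [AddCommGroup U] [Module Λ U] [Module k U]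
    [IsScalarTower k Λ U] (N : Submodule Λ A) :
    LinearMap.range (precomp k U N.mkQ) = LinearMap.ker (precomp k U N.subtype) := by
  ext f
  constructor
  · rintro ⟨g, rfl⟩
    ext x
    have : N.mkQ x = 0 := by simp
    change g (N.mkQ x) = 0
    rw [this, map_zero]
  · intro hf
    refine ⟨N.liftQ f fun x hx => ?_, by ext x; simp [precomp]⟩
    exact LinearMap.congr_fun hf ⟨x, hx⟩

/-- The image of a nonzero map from a simple module meets the essential submodule `X`, hence lies in
it. Evaluation at a nonzero element therefore embeds the Hom module into `X`. -/
theorem isNoetherian_hom_of_isSimpleModule (k : Type*) [CommRing k] [Algebra k Λ]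
    {J : Type*} [AddCommGroup J] [Module Λ J] [Module k J]
    [IsScalarTower k Λ J] {X : Submodule Λ J} (hX : IsEssentialIn X ⊤) [IsNoetherian k X]
    (S : Type*) [AddCommGroup S] [Module Λ S] [IsSimpleModule Λ S] :
    IsNoetherian k (S →ₗ[Λ] J) := by
  have hmem : ∀ (f : S →ₗ[Λ] J) (s : S), f s ∈ X := by
    intro f
    rcases f.injective_or_eq_zero with hf | rfl
    · have h1 : LinearMap.range f ⊓ X ≠ ⊥ := by
        intro h
        have := hX.2 _ le_top h
        have hf0 : f = 0 := LinearMap.range_eq_bot.1 this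
        have := IsSimpleModule.nontrivial Λ S
        obtain ⟨s, hs⟩ := exists_ne (0 : S)
        exact hs (hf (by simp [hf0]))
      obtain ⟨y, ⟨⟨s, rfl⟩, hy⟩, hy0⟩ := (Submodule.ne_bot_iff _).1 h1
      have hs : X.comap f = ⊤ := by
        rcases eq_bot_or_eq_top (X.comap f) with h | h
        · have : s ∈ X.comap f := hy
          rw [h, Submodule.mem_bot] at this
          exact absurd (by rw [this, map_zero]) hy0
        · exact h
      intro t
      have : t ∈ X.comap f := hs ▸ Submodule.mem_top
      exact this
    · intro s
      exact X.zero_mem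
  have := IsSimpleModule.nontrivial Λ S
  obtain ⟨s, hs⟩ := exists_ne (0 : S)
  let ev : (S →ₗ[Λ] J) →ₗ[k] X :=
    { toFun := fun f => ⟨f s, hmem f s⟩
      map_add' := fun _ _ => rfl
      map_smul' := fun _ _ => rfl }
  refine isNoetherian_of_injective ev ?_
  refine (injective_iff_map_eq_zero ev).2 fun f hf => ?_
  have hfs : f s = 0 := congrArg Subtype.val hf
  ext t
  have ht : t ∈ Submodule.span Λ {s} := by
    rw [IsSimpleModule.span_singleton_eq_top Λ hs]; exact Submodule.mem_top
  obtain ⟨a, rfl⟩ := Submodule.mem_span_singleton.1 ht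
  simp [hfs]

theorem isNoetherian_hom_of_isFiniteLength (k : Type*) [CommRing k] [Algebra k Λ]
    {J : Type*} [AddCommGroup J] [Module Λ J] [Module k J]
    [IsScalarTower k Λ J] {X : Submodule Λ J} (hX : IsEssentialIn X ⊤) [IsNoetherian k X]
    {N : Type*} [AddCommGroup N] [Module Λ N] (hN : IsFiniteLength Λ N) :
    IsNoetherian k (N →ₗ[Λ] J) := by
  induction hN with
  | @of_subsingleton N _ _ _ =>
    have : Subsingleton (N →ₗ[Λ] J) := ⟨fun f g => by ext x; rw [Subsingleton.elim x 0]; simp⟩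
    infer_instance
  | @of_simple_quotient N _ _ N₀ _ _ ih =>
    have := isNoetherian_hom_of_isSimpleModule k hX (N ⧸ N₀)
    exact isNoetherian_of_range_eq_ker _ _ (range_precomp_mkQ k J N₀)

variable (k : Type*) [CommRing k] [IsArtinianRing k] [Algebra k Λ] [Module.Finite k Λ]

-- `J ≅ Hom_Λ(Λ, J)`, and `Λ` has finite length over itself, so finiteness over `k` follows from the
-- case of simple modules by filtering `Λ`.
include k in
theorem finite_of_isEssentialIn {J : Type*} [AddCommGroup J] [Module Λ J] {X : Submodule Λ J}
    [Module.Finite Λ X] (hX : IsEssentialIn X ⊤) : Module.Finite Λ J := by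
  let : Module k J := Module.compHom J (algebraMap k Λ)
  have : IsScalarTower k Λ J := ⟨fun a b x => by
    rw [Algebra.smul_def, mul_smul]; rfl⟩
  have : Module.Finite k X := Module.Finite.trans Λ X
  have h1 : IsFiniteLength Λ Λ := isFiniteLength_iff_isNoetherian_isArtinian.2
    ⟨isNoetherian_of_tower k inferInstance, isArtinian_of_tower k inferInstance⟩
  have := isNoetherian_hom_of_isFiniteLength k hX h1
  have : Module.Finite k J := Module.Finite.equiv (LinearMap.ringLmapEquivSelf Λ k J)
  exact Module.Finite.of_restrictScalars_finite k Λ J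

theorem exists_maximal_isEssentialIn {J : Type*} [AddCommGroup J] [Module Λ J]
    (X : Submodule Λ J) : ∃ U, Maximal (IsEssentialIn X) U := by
  obtain ⟨U, _, hU⟩ := zorn_le_nonempty₀ {U | IsEssentialIn X U} (fun c hc hch U₀ hU₀ => by
    have hdir : DirectedOn (· ≤ ·) c := hch.directedOn
    refine ⟨sSup c, ⟨(hc hU₀).1.trans (le_sSup hU₀), fun V hV hVX => ?_⟩, fun U hU => le_sSup hU⟩
    refine (Submodule.eq_bot_iff _).2 fun v hv => ?_
    obtain ⟨U, hU, hvU⟩ := (Submodule.mem_sSup_of_directed ⟨U₀, hU₀⟩ hdir).1 (hV hv)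
    have h1 : Submodule.span Λ {v} = ⊥ := (hc hU).2 _
      ((Submodule.span_singleton_le_iff_mem _ _).2 hvU)
      (eq_bot_mono (inf_le_inf_right _ ((Submodule.span_singleton_le_iff_mem _ _).2 hv)) hVX)
    exact Submodule.span_singleton_eq_bot.1 h1) X ⟨le_rfl, fun V hV h => by
      rwa [inf_eq_left.2 hV] at h⟩
  exact ⟨U, hU⟩

theorem exists_maximal_disjoint {J : Type*} [AddCommGroup J] [Module Λ J]
    (U : Submodule Λ J) : ∃ V, Maximal (Disjoint U) V := by
  obtain ⟨V, _, hV⟩ := zorn_le_nonempty₀ {V | Disjoint U V} (fun c hc hch U₀ hU₀ =>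
    ⟨sSup c, hch.directedOn.disjoint_sSup_right.2 fun V hV => hc hV, fun U hU => le_sSup hU⟩)
    ⊥ disjoint_bot_right
  exact ⟨V, hV⟩

/-- With `V` maximal disjoint from `U`, injectivity extends the inclusion of `U` to `h : J ⧸ V → J`.
Its range is an essential extension of `X` containing `U`, so it equals `U`, and `h` after the
quotient map is a retraction. -/
theorem exists_retraction_of_maximal_isEssentialIn {J : Type u} [AddCommGroup J] [Module Λ J]
    [Module.Injective Λ J] {X U : Submodule Λ J} (hU : Maximal (IsEssentialIn X) U) :
    ∃ r : J →ₗ[Λ] U, ∀ x : U, r x = x := by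
  obtain ⟨V, hV⟩ := exists_maximal_disjoint U
  have hker : Function.Injective (V.mkQ ∘ₗ U.subtype) := by
    refine LinearMap.ker_eq_bot.1 ((Submodule.eq_bot_iff _).2 fun x hx => ?_)
    have : (x : J) ∈ V := by simpa using hx
    exact Subtype.ext (Submodule.disjoint_def.1 hV.1 x x.2 this)
  obtain ⟨h, hh⟩ := Module.Injective.out (Q := J) (V.mkQ ∘ₗ U.subtype) hker U.subtype
  have hhU : ∀ x ∈ U, h (V.mkQ x) = x := fun x hx => hh ⟨x, hx⟩
  -- By maximality of `V`, the image of `U` in `J ⧸ V` is essential.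
  have hmax : ∀ W : Submodule Λ (J ⧸ V), Disjoint U (W.comap V.mkQ) → W = ⊥ := by
    intro W hW
    have h1 : W.comap V.mkQ ≤ V := hV.2 hW (fun x hx => by
      have : V.mkQ x = 0 := by simpa using hx
      rw [Submodule.mem_comap, this]
      exact W.zero_mem)
    refine (Submodule.eq_bot_iff _).2 fun w hw => ?_
    obtain ⟨x, rfl⟩ := V.mkQ_surjective w
    have : x ∈ V := h1 hw
    simpa using this
  have hle : U ≤ LinearMap.range h := fun x hx => ⟨_, hhU x hx⟩
  have hess : IsEssentialIn X (LinearMap.range h) := by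
    refine ⟨hU.1.1.trans hle, fun W hW hWX => ?_⟩
    have hWU : W ⊓ U = ⊥ := hU.1.2 _ inf_le_right
      (eq_bot_mono (inf_le_inf_right _ inf_le_left) hWX)
    have h1 : W.comap h = ⊥ := by
      refine hmax _ (Submodule.disjoint_def.2 fun x hx hxW => ?_)
      have h2 : x ∈ W := hhU x hx ▸ hxW
      have : x ∈ W ⊓ U := ⟨h2, hx⟩
      simpa [hWU] using this
    refine (Submodule.eq_bot_iff _).2 fun w hw => ?_
    obtain ⟨y, rfl⟩ := hW hw
    have : y ∈ W.comap h := hw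
    rw [h1, Submodule.mem_bot] at this
    rw [this, map_zero]
  have hge : LinearMap.range h ≤ U := hU.2 hess hle
  exact ⟨LinearMap.codRestrict U (h ∘ₗ V.mkQ) fun x => hge ⟨_, rfl⟩,
    fun x => Subtype.ext (hhU x x.2)⟩

theorem injective_of_retraction {J : Type u} [AddCommGroup J] [Module Λ J]
    [Module.Injective Λ J] {U : Type u} [AddCommGroup U] [Module Λ U] (i : U →ₗ[Λ] J)
    (r : J →ₗ[Λ] U) (h : ∀ x, r (i x) = x) : Module.Injective Λ U where
  out A B _ _ _ _ f hf g := by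
    obtain ⟨l, hl⟩ := Module.Injective.out (Q := J) f hf (i ∘ₗ g)
    exact ⟨r ∘ₗ l, fun x => by simp [hl, h]⟩

include k in
/-- Over an artin algebra, every finitely generated module embeds into a finitely generated
injective module. -/
theorem exists_finite_injective (X : Type u) [AddCommGroup X] [Module Λ X] [Module.Finite Λ X] :
    ∃ (I : ModuleCat.{u} Λ) (f : X →ₗ[Λ] I), Module.Finite Λ I ∧ Injective I ∧
      Function.Injective f := by
  let J := Injective.under (ModuleCat.of Λ X)
  let i : X →ₗ[Λ] J := (Injective.ι (ModuleCat.of Λ X)).hom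
  have hi : Function.Injective i := (ModuleCat.mono_iff_injective _).1 inferInstance
  have : Module.Injective Λ J := by
    have : Injective (ModuleCat.of Λ J) := inferInstanceAs (Injective J)
    exact Module.injective_module_of_injective_object Λ J
  -- The maximal essential extension inside an injective module is a direct summand, hence
  -- injective; essentiality then gives finiteness.
  obtain ⟨U, hU⟩ := exists_maximal_isEssentialIn (LinearMap.range i)
  obtain ⟨r, hr⟩ := exists_retraction_of_maximal_isEssentialIn hU
  have hinj : Module.Injective Λ U := injective_of_retraction U.subtype r hr
  have hess : IsEssentialIn ((LinearMap.range i).comap U.subtype) ⊤ := by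
    refine ⟨le_top, fun V _ hV => ?_⟩
    have h1 : V.map U.subtype ⊓ LinearMap.range i = ⊥ := by
      refine (Submodule.eq_bot_iff _).2 ?_
      rintro _ ⟨⟨x, hx, rfl⟩, hx'⟩
      have : x ∈ V ⊓ (LinearMap.range i).comap U.subtype := ⟨hx, hx'⟩
      rw [hV, Submodule.mem_bot] at this
      rw [this, map_zero]
    have := hU.1.2 _ (Submodule.map_subtype_le U V) h1
    exact Submodule.map_injective_of_injective U.injective_subtype (by rw [this, Submodule.map_bot])
  have hfin : Module.Finite Λ ((LinearMap.range i).comap U.subtype) :=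
    Module.Finite.equiv (Submodule.comapSubtypeEquivOfLe hU.1.1).symm
  refine ⟨ModuleCat.of Λ U, LinearMap.codRestrict U i fun x => hU.1.1 ⟨x, rfl⟩,
    finite_of_isEssentialIn k hess, Module.injective_object_of_injective_module Λ U, ?_⟩
  intro x y hxy
  exact hi (congrArg Subtype.val hxy)

end InjectiveHull

/-! ### Elementary facts on `Hom_Λ(ω, -)` and `ω ⊗_Λ -`. -/

section Hom

variable {Λ : Type u} [Ring Λ] {ω : Type u} [AddCommGroup ω] [Module Λ ω]
variable {X : Type u} [AddCommGroup X] [Module Λ X]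

/-- The linear map underlying an element of `BHom`. -/
def BHom.lin (f : BHom Λ ω X) : ω →ₗ[Λ] X := f

/-- A linear map as an element of `BHom`. -/
def BHom.of (f : ω →ₗ[Λ] X) : BHom Λ ω X := f

theorem BHom.ext {f g : BHom Λ ω X} (h : ∀ w, f.lin w = g.lin w) : f = g :=
  LinearMap.ext (f := f.lin) (g := g.lin) h

@[simp] theorem BHom.lin_of (f : ω →ₗ[Λ] X) : (BHom.of f).lin = f := rfl

theorem BHom.lin_sum {ι : Type*} (s : Finset ι) (f : ι → BHom Λ ω X) (w : ω) :
    (∑ i ∈ s, f i).lin w = ∑ i ∈ s, (f i).lin w :=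
  map_sum (⟨⟨fun f : BHom Λ ω X => f.lin w, rfl⟩, fun _ _ => rfl⟩ : BHom Λ ω X →+ X) f s

theorem inAdd_pi (n : ℕ) : InAdd Λ ω (Fin n → ω) := by
  let e : (ULift.{u} (Fin n) →₀ ω) ≃ₗ[Λ] (Fin n → ω) :=
    (Finsupp.domLCongr Equiv.ulift).trans (Finsupp.linearEquivFunOnFinite Λ ω (Fin n))
  exact ⟨ULift (Fin n), e.symm.toLinearMap, e.toLinearMap, by ext1 x; simp⟩

end Hom

section Tensor

variable {Λ : Type u} [Ring Λ]
variable {ω : Type u} [AddCommGroup ω] [Module Λ ω] [Module Λᵐᵒᵖ ω]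
variable {X Y : Type u} [AddCommGroup X] [Module Λ X] [AddCommGroup Y] [Module Λ Y]

theorem tmul_op_smul (w : ω) (a : Λ) (x : X) :
    BTensor.tmul Λ ω X (MulOpposite.op a • w) x = BTensor.tmul Λ ω X w (a • x) :=
  (Submodule.Quotient.eq _).2 (Submodule.subset_span ⟨w, a, x, rfl⟩)

theorem BTensor.hom_ext {f g : BTensor Λ ω X →ₗ[Λ] Y}
    (h : ∀ w x, f (BTensor.tmul Λ ω X w x) = g (BTensor.tmul Λ ω X w x)) : f = g := by
  refine Submodule.linearMap_qext _ (LinearMap.ext fun t => ?_)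
  induction t with
  | zero => simp
  | add s t hs ht => rw [map_add, map_add, hs, ht]
  | tmul w x => exact h w x

end Tensor

/-! ### Finite projective and injective dimension in short exact sequences. -/

section Dimension

variable {Λ : Type u} [Ring Λ]
variable {X Y Z : Type u} [AddCommGroup X] [Module Λ X] [AddCommGroup Y] [Module Λ Y]
  [AddCommGroup Z] [Module Λ Z]

theorem exists_desc {f : X →ₗ[Λ] Y} {g : Y →ₗ[Λ] Z} (hg : Function.Surjective g)
    (hfg : Function.Exact f g) {W : Type*} [AddCommGroup W] [Module Λ W] (β : Y →ₗ[Λ] W)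
    (hβ : β ∘ₗ f = 0) : ∃ χ : Z →ₗ[Λ] W, χ ∘ₗ g = β := by
  have hle : LinearMap.ker g ≤ LinearMap.ker β := by
    intro y hy
    obtain ⟨x, rfl⟩ := (hfg y).1 hy
    exact LinearMap.congr_fun hβ x
  refine ⟨(LinearMap.ker g).liftQ β hle ∘ₗ (g.quotKerEquivOfSurjective hg).symm.toLinearMap, ?_⟩
  ext y
  have : (g.quotKerEquivOfSurjective hg).symm (g y) = Submodule.Quotient.mk y := by
    rw [LinearEquiv.symm_apply_eq]; rfl
  simp [this]

theorem InIInfty.of_equiv (h : InIInfty Λ X) (e : X ≃ₗ[Λ] Y) : InIInfty Λ Y := by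
  obtain ⟨hfin, n, hn⟩ := h
  exact ⟨Module.Finite.equiv e, n, hasInjectiveDimensionLT_of_iso e.toModuleIso (n + 1)⟩

theorem InPInfty.of_projective [Module.Finite Λ X] [Module.Projective Λ X] : InPInfty Λ X := by
  refine ⟨inferInstance, 0, ?_⟩
  have := (IsProjective.iff_projective (R := Λ) X).1 inferInstance
  infer_instance

theorem InPInfty.cokernel {f : X →ₗ[Λ] Y} {g : Y →ₗ[Λ] Z} (hf : Function.Injective f)
    (hg : Function.Surjective g) (hfg : Function.Exact f g) (hX : InPInfty Λ X)
    (hY : InPInfty Λ Y) : InPInfty Λ Z := by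
  obtain ⟨_, m, hm⟩ := hX
  obtain ⟨_, n, hn⟩ := hY
  obtain ⟨w, hS⟩ := exists_shortExact hf hg hfg
  refine ⟨Module.Finite.of_surjective g hg, m + n + 1, ?_⟩
  exact hS.hasProjectiveDimensionLT_X₃ (m + n + 1)
    (hasProjectiveDimensionLT_of_ge _ (m + 1) _ (by omega))
    (hasProjectiveDimensionLT_of_ge _ (n + 1) _ (by omega))

theorem InIInfty.cokernel {f : X →ₗ[Λ] Y} {g : Y →ₗ[Λ] Z} (hf : Function.Injective f)
    (hg : Function.Surjective g) (hfg : Function.Exact f g) (hX : InIInfty Λ X)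
    (hY : InIInfty Λ Y) : InIInfty Λ Z := by
  obtain ⟨_, m, hm⟩ := hX
  obtain ⟨_, n, hn⟩ := hY
  obtain ⟨w, hS⟩ := exists_shortExact hf hg hfg
  refine ⟨Module.Finite.of_surjective g hg, m + n, ?_⟩
  exact hS.hasInjectiveDimensionLT_X₃ (m + n + 1)
    (hasInjectiveDimensionLT_of_ge _ (n + 1) _ (by omega))
    (hasInjectiveDimensionLT_of_ge _ (m + 1) _ (by omega))

theorem InIInfty.kernel [IsNoetherianRing Λ] {f : X →ₗ[Λ] Y} {g : Y →ₗ[Λ] Z}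
    (hf : Function.Injective f)
    (hg : Function.Surjective g) (hfg : Function.Exact f g) (hY : InIInfty Λ Y)
    (hZ : InIInfty Λ Z) : InIInfty Λ X := by
  obtain ⟨_, m, hm⟩ := hY
  obtain ⟨_, n, hn⟩ := hZ
  obtain ⟨w, hS⟩ := exists_shortExact hf hg hfg
  refine ⟨Module.Finite.of_injective f hf, m + n + 1, ?_⟩
  exact hS.hasInjectiveDimensionLT_X₁ (m + n + 1)
    (hasInjectiveDimensionLT_of_ge _ (n + 1) _ (by omega))
    (hasInjectiveDimensionLT_of_ge _ (m + 1) _ (by omega))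

theorem InIInfty.prod (hX : InIInfty Λ X) (hY : InIInfty Λ Y) : InIInfty Λ (X × Y) := by
  obtain ⟨_, m, hm⟩ := hX
  obtain ⟨_, n, hn⟩ := hY
  obtain ⟨w, hS⟩ := exists_shortExact (LinearMap.inl_injective (R := Λ) (M := X) (M₂ := Y))
    LinearMap.snd_surjective (LinearMap.exact_iff.2 (LinearMap.ker_snd Λ X Y))
  refine ⟨inferInstance, m + n, ?_⟩
  exact hS.hasInjectiveDimensionLT_X₂ (m + n + 1)
    (hasInjectiveDimensionLT_of_ge _ (m + 1) _ (by omega))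
    (hasInjectiveDimensionLT_of_ge _ (n + 1) _ (by omega))

theorem InIInfty.pi (hX : InIInfty Λ X) (n : ℕ) : InIInfty Λ (Fin n → X) := by
  induction n with
  | zero =>
    refine ⟨inferInstance, 0, ?_⟩
    have := (ModuleCat.isZero_of_subsingleton
      (ModuleCat.of Λ (Fin 0 → X))).hasInjectiveDimensionLT_zero
    infer_instance
  | succ n ih => exact (hX.prod ih).of_equiv (Fin.consLinearEquiv Λ fun _ => X)

end Dimension

/-! ### Functoriality and adjoint maps for `ω`. -/

section Adjunction

variable {Λ : Type u} [Ring Λ]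
variable {ω : Type u} [AddCommGroup ω] [Module Λ ω] [Module Λᵐᵒᵖ ω] [SMulCommClass Λ Λᵐᵒᵖ ω]
variable {X Y Z : Type u} [AddCommGroup X] [Module Λ X] [AddCommGroup Y] [Module Λ Y]
  [AddCommGroup Z] [Module Λ Z]

@[simp] theorem BHom.lin_smul (a : Λ) (f : BHom Λ ω X) (w : ω) :
    (a • f).lin w = f.lin (MulOpposite.op a • w) := rfl

/-- The functor `Hom_Λ(ω, -)` on morphisms. -/
def BHom.map (g : X →ₗ[Λ] Y) : BHom Λ ω X →ₗ[Λ] BHom Λ ω Y where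
  toFun f := BHom.of (g ∘ₗ f.lin)
  map_add' _ _ := BHom.ext fun _ => map_add g _ _
  map_smul' _ _ := rfl

@[simp] theorem BHom.lin_map (g : X →ₗ[Λ] Y) (f : BHom Λ ω X) : (BHom.map g f).lin = g ∘ₗ f.lin :=
  rfl

/-- The map `ω ⊗_Λ X → Y` adjoint to `X → Hom_Λ(ω, Y)`. -/
noncomputable def BTensor.lift (s : X →ₗ[Λ] BHom Λ ω Y) : BTensor Λ ω X →ₗ[Λ] Y :=
  (balancedRel Λ ω X).liftQ
    (evalTensor Λ ω Y ∘ₗ TensorProduct.AlgebraTensorModule.map (LinearMap.id : ω →ₗ[Λ] ω)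
      (s.toAddMonoidHom.toIntLinearMap)) (by
    refine Submodule.span_le.2 ?_
    rintro _ ⟨w, a, x, rfl⟩
    rw [SetLike.mem_coe, LinearMap.mem_ker, map_sub, sub_eq_zero]
    change (s x).lin (MulOpposite.op a • w) = (s (a • x)).lin w
    rw [LinearMap.map_smul]
    rfl)

@[simp] theorem BTensor.lift_tmul (s : X →ₗ[Λ] BHom Λ ω Y) (w : ω) (x : X) :
    BTensor.lift s (BTensor.tmul Λ ω X w x) = (s x).lin w := rfl

@[simp] theorem adjCounit_tmul (w : ω) (h : BHom Λ ω X) :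
    adjCounit Λ ω X (BTensor.tmul Λ ω _ w h) = h.lin w := rfl

@[simp] theorem adjUnit_lin (x : X) (w : ω) :
    (adjUnit Λ ω X x).lin w = BTensor.tmul Λ ω X w x := rfl

end Adjunction

/-! ### Consequences of duality: covers by `ω`, Ext-vanishing, and CM modules. -/

section Dualizing

variable {Λ : Type u} [Ring Λ]
variable {ω : Type u} [AddCommGroup ω] [Module Λ ω] [Module Λᵐᵒᵖ ω] [SMulCommClass Λ Λᵐᵒᵖ ω]
variable {A B C X Y : Type u} [AddCommGroup A] [Module Λ A] [AddCommGroup B] [Module Λ B]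
  [AddCommGroup C] [Module Λ C] [AddCommGroup X] [Module Λ X] [AddCommGroup Y] [Module Λ Y]

/-- The cokernel `Q` of `Hom(ω, A) → Hom(ω, B)` has finite projective dimension, so its unit is
bijective. As `C` is a retract of `ω ⊗ Q`, a map `ω → C` gives a map `ω → ω ⊗ Q`, that is, an
element of `Q`; any representative in `Hom(ω, B)` is the lift. -/
theorem IsDualizing.exists_lift (hω : IsDualizing Λ ω) {f : A →ₗ[Λ] B} {g : B →ₗ[Λ] C}
    (hf : Function.Injective f) (hg : Function.Surjective g) (hfg : Function.Exact f g)
    (hA : InIInfty Λ A) (hB : InIInfty Λ B) (h : ω →ₗ[Λ] C) :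
    ∃ h' : ω →ₗ[Λ] B, g ∘ₗ h' = h := by
  let R := LinearMap.range (BHom.map (ω := ω) f)
  have hP : InPInfty Λ (BHom Λ ω B ⧸ R) := by
    refine InPInfty.cokernel (f := BHom.map (ω := ω) f) (g := R.mkQ) ?_ R.mkQ_surjective ?_
      (hω.hom_mem A hA) (hω.hom_mem B hB)
    · intro p q hpq
      exact BHom.ext fun w => hf (LinearMap.congr_fun (congrArg BHom.lin hpq) w)
    · exact LinearMap.exact_iff.2 R.ker_mkQ
  let eB := LinearEquiv.ofBijective _ (hω.counit_bijective B hB)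
  let β : B →ₗ[Λ] BTensor Λ ω (BHom Λ ω B ⧸ R) :=
    BTensor.lift (adjUnit Λ ω _ ∘ₗ R.mkQ) ∘ₗ eB.symm.toLinearMap
  have hβ : ∀ (b : BHom Λ ω B) (w : ω), β (b.lin w) = BTensor.tmul Λ ω _ w (R.mkQ b) := by
    intro b w
    have : eB.symm (b.lin w) = BTensor.tmul Λ ω _ w b := by
      rw [LinearEquiv.symm_apply_eq]; rfl
    simp only [β, LinearMap.comp_apply, LinearEquiv.coe_coe, this, BTensor.lift_tmul, adjUnit_lin]
  have hβf : β ∘ₗ f = 0 := by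
    have h1 : (β ∘ₗ f) ∘ₗ adjCounit Λ ω A = 0 := by
      refine BTensor.hom_ext fun w a => ?_
      have h2 : f (a.lin w) = (BHom.map f a).lin w := rfl
      have h3 : R.mkQ (BHom.map f a) = 0 := by
        rw [Submodule.mkQ_apply, Submodule.Quotient.mk_eq_zero]; exact ⟨a, rfl⟩
      rw [LinearMap.comp_apply, LinearMap.comp_apply, adjCounit_tmul, h2, hβ, h3,
        ← adjUnit_lin, map_zero]
      rfl
    ext a
    obtain ⟨t, rfl⟩ := (hω.counit_bijective A hA).2 a
    exact LinearMap.congr_fun h1 t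
  obtain ⟨χ, hχ⟩ := exists_desc hg hfg β hβf
  let ψ : BTensor Λ ω (BHom Λ ω B ⧸ R) →ₗ[Λ] C := BTensor.lift (R.liftQ (BHom.map g) (by
    rintro _ ⟨a, rfl⟩
    exact BHom.ext fun w => hfg.apply_apply_eq_zero _))
  have hψ : ∀ (b : BHom Λ ω B) (w : ω), ψ (BTensor.tmul Λ ω _ w (R.mkQ b)) = g (b.lin w) :=
    fun b w => rfl
  -- Both sides can be compared on pure tensors after precomposing with `g` and the counit of `B`,
  -- which are surjective.
  have hψχ : ∀ c, ψ (χ c) = c := by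
    have h1 : ψ ∘ₗ χ ∘ₗ g ∘ₗ adjCounit Λ ω B = g ∘ₗ adjCounit Λ ω B := by
      refine BTensor.hom_ext fun w b => ?_
      have h2 : χ (g (b.lin w)) = β (b.lin w) := LinearMap.congr_fun hχ _
      rw [LinearMap.comp_apply, LinearMap.comp_apply, LinearMap.comp_apply, adjCounit_tmul, h2, hβ,
        hψ]
    intro c
    obtain ⟨b, rfl⟩ := hg c
    obtain ⟨t, rfl⟩ := (hω.counit_bijective B hB).2 b
    exact LinearMap.congr_fun h1 t
  obtain ⟨x, hx⟩ := (hω.unit_bijective _ hP).2 (BHom.of (χ ∘ₗ h))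
  obtain ⟨b, rfl⟩ := R.mkQ_surjective x
  refine ⟨b.lin, LinearMap.ext fun w => ?_⟩
  have h1 : BTensor.tmul Λ ω _ w (R.mkQ b) = χ (h w) :=
    LinearMap.congr_fun (congrArg BHom.lin hx) w
  rw [LinearMap.comp_apply, ← hψ, h1, hψχ]

variable (Λ ω) in
/-- Right multiplication `Λ → Hom_Λ(ω, ω)`. -/
def rmul : Λ →ₗ[Λ] BHom Λ ω ω where
  toFun a := BHom.of
    { toFun := fun w => MulOpposite.op a • w
      map_add' := fun v w => smul_add _ v w
      map_smul' := fun b w => (smul_comm b _ w).symm }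
  map_add' a b := BHom.ext fun w => by
    change MulOpposite.op (a + b) • w = MulOpposite.op a • w + MulOpposite.op b • w
    rw [MulOpposite.op_add, add_smul]
  map_smul' a b := BHom.ext fun w => by
    change MulOpposite.op (a * b) • w = MulOpposite.op b • MulOpposite.op a • w
    rw [MulOpposite.op_mul, mul_smul]

@[simp] theorem rmul_lin (a : Λ) (w : ω) : (rmul Λ ω a).lin w = MulOpposite.op a • w := rfl

variable (Λ ω) in
/-- The isomorphism `ω ≅ ω ⊗_Λ Λ`. -/
noncomputable def tensorSelf : ω ≃ₗ[Λ] BTensor Λ ω Λ :=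
  LinearEquiv.ofLinearMap (adjUnit Λ ω Λ 1).lin (BTensor.lift (rmul Λ ω))
    (BTensor.hom_ext fun w a => by
      rw [LinearMap.comp_apply, BTensor.lift_tmul, rmul_lin, adjUnit_lin, tmul_op_smul,
        smul_eq_mul, mul_one]
      rfl)
    (LinearMap.ext fun w => by
      rw [LinearMap.comp_apply, adjUnit_lin, BTensor.lift_tmul, rmul_lin, MulOpposite.op_one,
        one_smul]
      rfl)

/-- Under `ω ≅ ω ⊗_Λ Λ`, right multiplication becomes the unit at `Λ`. -/
theorem IsDualizing.rmul_bijective (hω : IsDualizing Λ ω) : Function.Bijective (rmul Λ ω) := by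
  have h0 : ∀ a, BHom.map (tensorSelf Λ ω).toLinearMap (rmul Λ ω a) = adjUnit Λ ω Λ a := by
    intro a
    refine BHom.ext fun w => ?_
    change BTensor.tmul Λ ω Λ (MulOpposite.op a • w) 1 = _
    rw [tmul_op_smul, smul_eq_mul, mul_one]
    rfl
  have hbij := hω.unit_bijective Λ .of_projective
  constructor
  · intro a b hab
    exact hbij.1 (by rw [← h0, hab, h0])
  · intro φ
    obtain ⟨a, ha⟩ := hbij.2 (BHom.map (tensorSelf Λ ω).toLinearMap φ)
    refine ⟨a, BHom.ext fun w => (tensorSelf Λ ω).injective ?_⟩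
    exact LinearMap.congr_fun (congrArg BHom.lin ((h0 a).trans ha)) w

theorem IsDualizing.inIInfty (hω : IsDualizing Λ ω) : InIInfty Λ ω :=
  (hω.tensor_mem Λ .of_projective).of_equiv (tensorSelf Λ ω).symm

theorem IsDualizing.projective_hom_pi (hω : IsDualizing Λ ω) (n : ℕ) :
    Module.Projective Λ (BHom Λ ω (Fin n → ω)) := by
  let f : (Fin n → Λ) →ₗ[Λ] BHom Λ ω (Fin n → ω) :=
    { toFun := fun c => BHom.of (LinearMap.pi fun i => (rmul Λ ω (c i)).lin)
      map_add' := fun c d => BHom.ext fun w => by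
        ext i
        change (rmul Λ ω (c i + d i)).lin w = _
        rw [map_add]
        rfl
      map_smul' := fun a c => BHom.ext fun w => by
        ext i
        change (rmul Λ ω (a • c i)).lin w = _
        rw [map_smul]
        rfl }
  have hf : Function.Bijective f := by
    constructor
    · intro c d hcd
      ext i
      refine hω.rmul_bijective.1 (BHom.ext fun w => ?_)
      exact congrFun (LinearMap.congr_fun (congrArg BHom.lin hcd) w) i
    · intro h
      choose c hc using fun i => hω.rmul_bijective.2 (BHom.of (LinearMap.proj i ∘ₗ h.lin))
      refine ⟨c, BHom.ext fun w => ?_⟩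
      ext i
      exact LinearMap.congr_fun (congrArg BHom.lin (hc i)) w
  exact Module.Projective.of_equiv (LinearEquiv.ofBijective f hf)

/-- A module of finite injective dimension is covered by a finite power of `ω`, and the cover
induces a surjection on `Hom_Λ(ω, -)`. -/
theorem IsDualizing.exists_cover (hω : IsDualizing Λ ω) (hY : InIInfty Λ Y) :
    ∃ (n : ℕ) (p : (Fin n → ω) →ₗ[Λ] Y), Function.Surjective p ∧
      Function.Surjective (BHom.map (ω := ω) p) := by
  have := (hω.hom_mem Y hY).1
  obtain ⟨n, h, hh⟩ := Module.Finite.exists_fin (R := Λ) (M := BHom Λ ω Y)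
  let p : (Fin n → ω) →ₗ[Λ] Y := ∑ i, (h i).lin ∘ₗ LinearMap.proj i
  have hp : Function.Surjective (BHom.map (ω := ω) p) := by
    intro φ
    obtain ⟨c, rfl⟩ := (Submodule.mem_span_range_iff_exists_fun Λ).1
      (hh ▸ Submodule.mem_top : φ ∈ Submodule.span Λ (Set.range h))
    -- Scalars act on `Hom_Λ(ω, Y)` through the right action on `ω`, so the combination `∑ c i • h
    -- i` is `p` preceded by right multiplications.
    refine ⟨BHom.of (LinearMap.pi fun i => (rmul Λ ω (c i)).lin), BHom.ext fun w => ?_⟩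
    rw [BHom.lin_sum]
    simp [p]
  refine ⟨n, p, fun y => ?_, hp⟩
  -- Every map `ω → Y` factors through `p`, so `p` is onto because the counit is.
  have h1 : LinearMap.range (adjCounit Λ ω Y) ≤ LinearMap.range p := by
    have : (LinearMap.range p).mkQ ∘ₗ adjCounit Λ ω Y = 0 := by
      refine BTensor.hom_ext fun w φ => ?_
      obtain ⟨φ, rfl⟩ := hp φ
      simp
    rintro _ ⟨t, rfl⟩
    simpa using LinearMap.congr_fun this t
  exact h1 ((hω.counit_bijective Y hY).2 y)

variable (k : Type*) [CommRing k] [IsArtinianRing k] [Algebra k Λ] [Module.Finite k Λ]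

-- Induction on the injective dimension: embed `A` into a finitely generated injective, whose
-- cokernel has smaller dimension. The degree-one group vanishes by `IsDualizing.exists_lift`.
include k in
theorem IsDualizing.extVanishes_of_inIInfty (hω : IsDualizing Λ ω) (n : ℕ) :
    ∀ (A : Type u) [AddCommGroup A] [Module Λ A], Module.Finite Λ A →
      HasInjectiveDimensionLE (ModuleCat.of Λ A) n → ExtVanishes Λ ω A 1 := by
  induction n with
  | zero => exact fun A _ _ _ hA => .of_hasInjectiveDimensionLT hA
  | succ n ih =>
    intro A _ _ hfin hA
    obtain ⟨I, f, hI, hinj, hf⟩ := exists_finite_injective k (Λ := Λ) A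
    have hfg : Function.Exact f (LinearMap.range f).mkQ := LinearMap.exact_iff.2 (by simp)
    have hII : Injective (ModuleCat.of Λ I) := hinj
    have hI' : InIInfty Λ I := ⟨hI, 0, inferInstance⟩
    obtain ⟨w, hS⟩ := exists_shortExact hf (LinearMap.range f).mkQ_surjective hfg
    have hC : HasInjectiveDimensionLE (ModuleCat.of Λ (I ⧸ LinearMap.range f)) n :=
      hS.hasInjectiveDimensionLT_X₃ (n + 1) (hasInjectiveDimensionLT_of_ge _ 1 _ (by omega)) hA
    exact ExtVanishes.kernel_right hf (LinearMap.range f).mkQ_surjective hfg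
      (ih _ inferInstance hC) (.of_injective hII)
      (hω.exists_lift hf (LinearMap.range f).mkQ_surjective hfg ⟨hfin, _, hA⟩ hI')

include k in
theorem IsDualizing.extVanishes_self (hω : IsDualizing Λ ω) : ExtVanishes Λ ω ω 1 := by
  obtain ⟨hfin, n, hn⟩ := hω.inIInfty
  exact hω.extVanishes_of_inIInfty k n ω hfin hn

/-- If `Hom(ω, Y)` is projective, then `Y` is a summand of some `ω^n`. In general the kernel of a
cover `ω^n → Y` lowers the projective dimension of `Hom(ω, -)`, because `Hom(ω, ω^n)` is projective
and the cover stays surjective under `Hom(ω, -)`. -/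
theorem IsDualizing.extVanishes_of_hom [IsNoetherianRing Λ] (hω : IsDualizing Λ ω)
    (hX : ExtVanishes Λ X ω 1) (r : ℕ) :
    ∀ (Y : Type u) [AddCommGroup Y] [Module Λ Y], InIInfty Λ Y →
      HasProjectiveDimensionLE (ModuleCat.of Λ (BHom Λ ω Y)) r → ExtVanishes Λ X Y 1 := by
  induction r with
  | zero =>
    intro Y _ _ hY hr
    obtain ⟨n, p, hp, hp'⟩ := hω.exists_cover hY
    have : Module.Projective Λ (BHom Λ ω Y) :=
      (IsProjective.iff_projective (R := Λ) (BHom Λ ω Y)).2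
        ((projective_iff_hasProjectiveDimensionLE_zero _).2 hr)
    obtain ⟨s, hs⟩ := Module.projective_lifting_property (BHom.map (ω := ω) p) LinearMap.id hp'
    let e := LinearEquiv.ofBijective _ (hω.counit_bijective Y hY)
    refine (hX.pi_right n).of_retract_right (BTensor.lift s ∘ₗ e.symm.toLinearMap) p ?_
    have h1 : p ∘ₗ BTensor.lift s = adjCounit Λ ω Y := by
      refine BTensor.hom_ext fun w h => ?_
      exact LinearMap.congr_fun (congrArg BHom.lin (LinearMap.congr_fun hs h)) w
    rw [← LinearMap.comp_assoc, h1]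
    ext y
    exact e.apply_symm_apply y
  | succ r ih =>
    intro Y _ _ hY hr
    obtain ⟨n, p, hp, hp'⟩ := hω.exists_cover hY
    let Z := LinearMap.ker p
    have hex : Function.Exact Z.subtype p := LinearMap.exact_iff.2 (by simp [Z])
    have hZ : InIInfty Λ Z := .kernel Z.injective_subtype hp hex (hω.inIInfty.pi n) hY
    have hexH : Function.Exact (BHom.map (ω := ω) Z.subtype) (BHom.map (ω := ω) p) := by
      intro h
      constructor
      · intro hh
        refine ⟨BHom.of (h.lin.codRestrict Z fun w => ?_), rfl⟩
        exact LinearMap.congr_fun (congrArg BHom.lin hh) w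
      · rintro ⟨h', rfl⟩
        exact BHom.ext fun w => hex.apply_apply_eq_zero _
    have hinj : Function.Injective (BHom.map (ω := ω) Z.subtype) := fun a b hab =>
      BHom.ext fun w => Z.injective_subtype (LinearMap.congr_fun (congrArg BHom.lin hab) w)
    obtain ⟨w, hS⟩ := exists_shortExact hinj hp' hexH
    have := (IsProjective.iff_projective (R := Λ) _).1 (hω.projective_hom_pi n)
    have hr' : HasProjectiveDimensionLE (ModuleCat.of Λ (BHom Λ ω Z)) r :=
      hS.hasProjectiveDimensionLT_X₁ (r + 1) (hasProjectiveDimensionLT_of_ge _ 1 _ (by omega)) hr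
    exact ExtVanishes.cokernel_right Z.injective_subtype hp hex
      ((ih Z hZ hr').mono (by omega)) (hX.pi_right n)

include k in
/-- A finitely generated module without extensions by `ω` embeds into a finite power of `ω`. -/
theorem IsDualizing.exists_embedding [IsNoetherianRing Λ] (hω : IsDualizing Λ ω)
    [Module.Finite Λ X] (hX : ExtVanishes Λ X ω 1) :
    ∃ (n : ℕ) (f : X →ₗ[Λ] (Fin n → ω)), Function.Injective f := by
  obtain ⟨I, i, hI, hinj, hi⟩ := exists_finite_injective k (Λ := Λ) X
  have hII : Injective (ModuleCat.of Λ I) := hinj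
  have hI' : InIInfty Λ I := ⟨hI, 0, inferInstance⟩
  obtain ⟨n, p, hp, hp'⟩ := hω.exists_cover hI'
  let Z := LinearMap.ker p
  have hex : Function.Exact Z.subtype p := LinearMap.exact_iff.2 (by simp [Z])
  have hZ : InIInfty Λ Z := .kernel Z.injective_subtype hp hex (hω.inIInfty.pi n) hI'
  obtain ⟨r, hr⟩ := (hω.hom_mem Z hZ).2
  -- Since `Ext^1(X, Z) = 0`, the embedding into `I` lifts to `ω^n`; the lift is injective because
  -- its composite with `p` is.
  obtain ⟨f, hf⟩ := ExtVanishes.exists_lift Z.injective_subtype hp hex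
    (hω.extVanishes_of_hom hX r Z hZ hr) i
  refine ⟨n, f, fun x y hxy => hi ?_⟩
  rw [← hf, LinearMap.comp_apply, hxy, LinearMap.comp_apply]

include k in
/-- A finitely generated module without extensions by `ω` has an injective left approximation by
a finite power of `ω`. -/
theorem IsDualizing.exists_approximation [IsNoetherianRing Λ] (hω : IsDualizing Λ ω)
    [Module.Finite Λ X] (hX : ExtVanishes Λ X ω 1) :
    ∃ (n : ℕ) (f : X →ₗ[Λ] (Fin n → ω)), Function.Injective f ∧
      ∀ φ : X →ₗ[Λ] ω, ∃ ψ : (Fin n → ω) →ₗ[Λ] ω, ψ ∘ₗ f = φ := by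
  let : Module k ω := Module.compHom ω (algebraMap k Λ)
  have : IsScalarTower k Λ ω := ⟨fun a b x => by
    rw [Algebra.smul_def, mul_smul]; rfl⟩
  have := hω.finite
  have : Module.Finite k ω := Module.Finite.trans Λ ω
  have hfin : Module.Finite k (X →ₗ[Λ] ω) := by
    obtain ⟨m, x, hx⟩ := Module.Finite.exists_fin (R := Λ) (M := X)
    let ev : (X →ₗ[Λ] ω) →ₗ[k] (Fin m → ω) :=
      { toFun := fun f i => f (x i)
        map_add' := fun _ _ => rfl
        map_smul' := fun _ _ => rfl }
    refine Module.Finite.of_injective ev fun f g hfg => ?_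
    refine LinearMap.ext_on hx ?_
    rintro _ ⟨i, rfl⟩
    exact congrFun hfg i
  obtain ⟨n, f, hf⟩ := Module.Finite.exists_fin (R := k) (M := X →ₗ[Λ] ω)
  have hφ : ∀ φ : X →ₗ[Λ] ω, ∃ ψ : (Fin n → ω) →ₗ[Λ] ω, ψ ∘ₗ LinearMap.pi f = φ := by
    intro φ
    obtain ⟨c, rfl⟩ := (Submodule.mem_span_range_iff_exists_fun k).1
      (hf ▸ Submodule.mem_top : φ ∈ Submodule.span k (Set.range f))
    refine ⟨∑ i, c i • LinearMap.proj i, ?_⟩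
    ext x
    simp
  refine ⟨n, LinearMap.pi f, ?_, hφ⟩
  -- Some embedding into a power of `ω` exists, and its coordinates factor through the
  -- approximation, which is therefore injective.
  obtain ⟨m, g, hg⟩ := hω.exists_embedding k hX
  intro x y hxy
  refine hg (funext fun i => ?_)
  obtain ⟨ψ, hψ⟩ := hφ (LinearMap.proj i ∘ₗ g)
  have h1 := LinearMap.congr_fun hψ x
  have h2 := LinearMap.congr_fun hψ y
  rw [LinearMap.comp_apply, hxy] at h1
  exact h1.symm.trans h2

include k in
/-- A finitely generated module without extensions by `ω` is Cohen-Macaulay. -/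
theorem IsDualizing.isGorensteinProjective [IsNoetherianRing Λ] (hω : IsDualizing Λ ω)
    [Module.Finite Λ X] (hX : ExtVanishes Λ X ω 1) : IsGorensteinProjective Λ ω X := by
  -- The vanishing condition passes to the cokernel of an approximation, so the approximation step
  -- can be iterated on this class.
  let T := {X : ModuleCat.{u} Λ // Module.Finite Λ X ∧ ExtVanishes Λ X ω 1}
  have step : ∀ X : T, ∃ (n : ℕ) (f : X.1 →ₗ[Λ] (Fin n → ω)), Function.Injective f ∧
      ExtVanishes Λ ((Fin n → ω) ⧸ LinearMap.range f) ω 1 := by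
    rintro ⟨X, hfin, hX⟩
    obtain ⟨n, f, hf, hφ⟩ := hω.exists_approximation (X := X) k hX
    exact ⟨n, f, hf, ExtVanishes.cokernel_left hf (LinearMap.range f).mkQ_surjective
      (LinearMap.exact_iff.2 (by simp)) hX ((hω.extVanishes_self k).pi_left n) hφ⟩
  choose n f hf hq using step
  have := hω.finite
  let next : T → T := fun X =>
    ⟨ModuleCat.of Λ ((Fin (n X) → ω) ⧸ LinearMap.range (f X)),
      inferInstanceAs (Module.Finite Λ ((Fin (n X) → ω) ⧸ LinearMap.range (f X))), hq X⟩
  let seq : ℕ → T := fun i => next^[i] ⟨ModuleCat.of Λ X, ‹_›, hX⟩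
  have hseq : ∀ i, seq (i + 1) = next (seq i) := fun i => Function.iterate_succ_apply' _ _ _
  -- The differentials are recorded only by kernel and range: the equality `seq (i + 1) = next (seq
  -- i)` can then be rewritten before choosing them, with no transport.
  have hd : ∀ i, ∃ d : (Fin (n (seq i)) → ω) →ₗ[Λ] (Fin (n (seq (i + 1))) → ω),
      LinearMap.ker d = LinearMap.range (f (seq i)) ∧
      LinearMap.range d = LinearMap.range (f (seq (i + 1))) := by
    intro i
    rw [hseq i]
    refine ⟨f (next (seq i)) ∘ₗ (LinearMap.range (f (seq i))).mkQ, ?_, ?_⟩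
    · rw [LinearMap.ker_comp_of_ker_eq_bot _ (LinearMap.ker_eq_bot.2 (hf _)), Submodule.ker_mkQ]
    · exact LinearMap.range_comp_of_range_eq_top _ (Submodule.range_mkQ _)
  choose d hker hrange using hd
  have h₀ : Function.Exact (f (seq 0)) (d 0) := LinearMap.exact_iff.2 (hker 0)
  refine ⟨fun i => ModuleCat.of Λ (Fin (n (seq i)) → ω), f (seq 0), d, fun i => inAdd_pi _,
    hf _, h₀, fun i => LinearMap.exact_iff.2 ?_⟩
  rw [hker, hrange]

end Dualizing

/-! ### Coresolutions by `Add ω` and factorization through Ext-vanishing modules. -/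

section Gorenstein

variable {Λ : Type u} [Ring Λ] {ω : Type u} [AddCommGroup ω] [Module Λ ω]

theorem InAdd.prod {V W : Type u} [AddCommGroup V] [Module Λ V] [AddCommGroup W] [Module Λ W]
    (hV : InAdd Λ ω V) (hW : InAdd Λ ω W) : InAdd Λ ω (V × W) := by
  obtain ⟨ι, i, p, hpi⟩ := hV
  obtain ⟨κ, j, q, hqj⟩ := hW
  let e := Finsupp.sumFinsuppLEquivProdFinsupp Λ (α := ι) (β := κ) (M := ω)
  refine ⟨ι ⊕ κ, e.symm.toLinearMap ∘ₗ i.prodMap j, p.prodMap q ∘ₗ e.toLinearMap, ?_⟩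
  refine LinearMap.ext fun x => ?_
  have h1 : p (i x.1) = x.1 := LinearMap.congr_fun hpi x.1
  have h2 : q (j x.2) = x.2 := LinearMap.congr_fun hqj x.2
  simp [h1, h2]

/-- The first term of an `Add ω`-coresolution can be taken to be a direct sum of copies of `ω`. -/
theorem IsGorensteinProjective.exists_embedding {M : Type u} [AddCommGroup M] [Module Λ M]
    (hM : IsGorensteinProjective Λ ω M) :
    ∃ (ι : Type u) (ε : M →ₗ[Λ] (ι →₀ ω)), Function.Injective ε ∧
      IsGorensteinProjective Λ ω ((ι →₀ ω) ⧸ LinearMap.range ε) := by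
  obtain ⟨W, ε, d, hW, hε, hεd, hd⟩ := hM
  obtain ⟨ι, i, p, hpi⟩ := hW 0
  have hpi' : ∀ x, p (i x) = x := LinearMap.congr_fun hpi
  have hi : Function.Injective i := Function.LeftInverse.injective hpi'
  refine ⟨ι, i ∘ₗ ε, hi.comp hε, ?_⟩
  let K := LinearMap.ker p
  let r : (ι →₀ ω) →ₗ[Λ] K := (LinearMap.id - i ∘ₗ p).codRestrict K fun x => by
    simp [K, hpi']
  have hr : ∀ x, (r x : ι →₀ ω) = x - i (p x) := fun x => rfl
  have hK : InAdd Λ ω K := ⟨ι, K.subtype, r, LinearMap.ext fun x => Subtype.ext (by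
    have : p x = 0 := x.2
    simp [hr, this])⟩
  -- `W 0` is enlarged by its complement `K` to a direct sum of copies of `ω`; adding `K` to `W 1`
  -- as well preserves exactness.
  let δ : (ι →₀ ω) →ₗ[Λ] (W 1 × K) := (d 0 ∘ₗ p).prod r
  have hδ : LinearMap.ker δ = LinearMap.range (i ∘ₗ ε) := by
    ext x
    constructor
    · intro hx
      have h1 : d 0 (p x) = 0 := congrArg Prod.fst hx
      have h2 : r x = 0 := congrArg Prod.snd hx
      obtain ⟨m, hm⟩ := (hεd (p x)).1 h1
      refine ⟨m, ?_⟩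
      rw [LinearMap.comp_apply, hm]
      exact (sub_eq_zero.1 ((hr x).symm.trans (congrArg Subtype.val h2))).symm
    · rintro ⟨m, rfl⟩
      refine Prod.ext ?_ (Subtype.ext ?_)
      · change d 0 (p (i (ε m))) = 0
        rw [hpi', hεd.apply_apply_eq_zero]
      · change i (ε m) - i (p (i (ε m))) = 0
        rw [hpi', sub_self]
  let W' : ℕ → ModuleCat.{u} Λ := fun n => match n with
    | 0 => ModuleCat.of Λ (W 1 × K)
    | n + 1 => W (n + 2)
  let d' : ∀ n, W' n →ₗ[Λ] W' (n + 1) := fun n => match n with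
    | 0 => d 1 ∘ₗ LinearMap.fst Λ (W 1) K
    | n + 1 => d (n + 2)
  have h0 : LinearMap.ker (d 1 ∘ₗ LinearMap.fst Λ (W 1) K) = LinearMap.range δ := by
    ext ⟨y, z⟩
    constructor
    · intro hy
      obtain ⟨x, rfl⟩ := (hd 0 y).1 hy
      have hz : p z = 0 := z.2
      refine ⟨i x + z, Prod.ext ?_ (Subtype.ext ?_)⟩
      · change d 0 (p (i x + z)) = _
        rw [map_add, hz, hpi', add_zero]
      · change (i x + z) - i (p (i x + z)) = z
        rw [map_add, hz, hpi', add_zero, add_sub_cancel_left]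
    · rintro ⟨x, hx⟩
      rw [← hx]
      exact (hd 0).apply_apply_eq_zero (p x)
  refine ⟨W', (LinearMap.range (i ∘ₗ ε)).liftQ δ hδ.ge, d', ?_, ?_, ?_, ?_⟩
  · rintro (_ | n)
    · exact (hW 1).prod hK
    · exact hW (n + 2)
  · rw [← LinearMap.ker_eq_bot]
    exact Submodule.ker_liftQ_eq_bot _ _ _ hδ.le
  · have : Function.Exact ((LinearMap.range (i ∘ₗ ε)).liftQ δ hδ.ge)
        (d 1 ∘ₗ LinearMap.fst Λ (W 1) K) :=
      LinearMap.exact_iff.2 (by rw [Submodule.range_liftQ, h0])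
    exact this
  · rintro (_ | n)
    · have : Function.Exact (d 1 ∘ₗ LinearMap.fst Λ (W 1) K) (d 2) :=
        LinearMap.exact_iff.2 (by
          rw [LinearMap.range_comp_of_range_eq_top _
            (LinearMap.range_eq_top.2 LinearMap.fst_surjective)]
          exact LinearMap.exact_iff.1 (hd 1))
      exact this
    · exact hd (n + 2)

theorem exists_range_le_supported {ι : Type*} {F : Type*} [AddCommGroup F] [Module Λ F]
    [Module.Finite Λ F] (g : F →ₗ[Λ] (ι →₀ ω)) :
    ∃ s : Finset ι, LinearMap.range g ≤ Finsupp.supported ω Λ (s : Set ι) := by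
  classical
  obtain ⟨n, x, hx⟩ := Module.Finite.exists_fin (R := Λ) (M := F)
  refine ⟨Finset.univ.biUnion fun i => (g (x i)).support, ?_⟩
  rw [LinearMap.range_eq_map, ← hx, Submodule.map_span_le]
  rintro _ ⟨i, rfl⟩
  rw [Finsupp.mem_supported]
  exact Finset.coe_subset.2
    (Finset.subset_biUnion_of_mem (fun i => (g (x i)).support) (Finset.mem_univ i))

theorem exists_supported_equiv {ι : Type*} (s : Finset ι) :
    ∃ n : ℕ, Nonempty (Finsupp.supported ω Λ (s : Set ι) ≃ₗ[Λ] (Fin n → ω)) :=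
  ⟨s.card, ⟨(Finsupp.supportedEquivFinsupp (s : Set ι)).trans
    ((Finsupp.linearEquivFunOnFinite Λ ω _).trans
      (LinearEquiv.funCongrLeft Λ ω s.equivFin.symm))⟩⟩

theorem ExtVanishes.of_equiv_left {X Y Z : Type u} [AddCommGroup X] [Module Λ X] [AddCommGroup Y]
    [Module Λ Y] [AddCommGroup Z] [Module Λ Z] {j : ℕ} (h : ExtVanishes Λ X Z j)
    (e : Y ≃ₗ[Λ] X) : ExtVanishes Λ Y Z j :=
  h.of_retract_left e.toLinearMap e.symm.toLinearMap (by ext1 x; simp)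

/-- Homomorphisms from finitely generated modules to an `ω`-Gorenstein projective module factor
through finitely generated modules whose extension groups with `ω` vanish in degrees above `j`. -/
theorem exists_factorization [IsNoetherianRing Λ] [Module.Finite Λ ω] {n : ℕ}
    (hn : HasInjectiveDimensionLE (ModuleCat.of Λ ω) n) (hω : ExtVanishes Λ ω ω 1) (t : ℕ) :
    ∀ (j : ℕ), n ≤ j + t → ∀ (M F : Type u) [AddCommGroup M] [Module Λ M] [AddCommGroup F]
      [Module Λ F], IsGorensteinProjective Λ ω M → Module.Finite Λ F → ∀ g : F →ₗ[Λ] M,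
      ∃ (X : ModuleCat.{u} Λ) (a : F →ₗ[Λ] X) (b : X →ₗ[Λ] M), Module.Finite Λ X ∧
        ExtVanishes Λ X ω (j + 1) ∧ b ∘ₗ a = g := by
  induction t with
  | zero =>
    intro j hj M F _ _ _ _ hM hF g
    -- Here `n ≤ j`, so the injective dimension of `ω` alone gives the vanishing and `F` itself
    -- serves.
    have := hasInjectiveDimensionLT_of_ge (ModuleCat.of Λ ω) (n + 1) (j + 1) (by omega)
    exact ⟨ModuleCat.of Λ F, LinearMap.id, g, hF, .of_hasInjectiveDimensionLT this, rfl⟩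
  | succ t ih =>
    intro j hj M F _ _ _ _ hM hF g
    obtain ⟨ι, ε, hε, hM₁⟩ := hM.exists_embedding
    obtain ⟨s, hs⟩ := exists_range_le_supported (ε ∘ₗ g)
    let π := (LinearMap.range ε).mkQ
    let L := Finsupp.supported ω Λ (s : Set ι)
    obtain ⟨m, ⟨e⟩⟩ := exists_supported_equiv (Λ := Λ) (ω := ω) s
    have hLfin : Module.Finite Λ L := Module.Finite.equiv e.symm
    have hL : ExtVanishes Λ L ω 1 := (hω.pi_left m).of_equiv_left e
    let c : L →ₗ[Λ] LinearMap.range (π ∘ₗ L.subtype) := (π ∘ₗ L.subtype).rangeRestrict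
    -- The image of `F` lies in a finite power `L` of `ω`. The induction applies to the image of `L`
    -- in the next cosyzygy of `M`, with vanishing from one degree later.
    obtain ⟨X₁, a₁, b₁, hX₁, hX₁ω, hab⟩ := ih (j + 1) (by omega) _
      (LinearMap.range (π ∘ₗ L.subtype)) hM₁ inferInstance (Submodule.subtype _)
    have hab' : ∀ x, b₁ (a₁ (c x)) = π x := fun x => LinearMap.congr_fun hab (c x)
    obtain ⟨r, q, hq⟩ := Module.Finite.exists_fin' Λ X₁
    obtain ⟨l, hl⟩ := Module.projective_lifting_property π (b₁ ∘ₗ q) (Submodule.mkQ_surjective _)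
    have hl' : ∀ x, π (l x) = b₁ (q x) := LinearMap.congr_fun hl
    let φ : ((Fin r → Λ) × L) →ₗ[Λ] X₁ := q.coprod (a₁ ∘ₗ c)
    have hφ : Function.Surjective φ := fun x => by
      obtain ⟨y, rfl⟩ := hq x
      exact ⟨(y, 0), by simp [φ]⟩
    -- `X` is a syzygy of `X₁` relative to `Λ^r ⊕ L`, so its Ext-vanishing starts one degree
    -- earlier. The lift `l` makes the map to `ι →₀ ω` vanish modulo `M` on `X`, and `F` enters
    -- through the summand `L`.
    let X := LinearMap.ker φ
    let v : X →ₗ[Λ] (ι →₀ ω) := l.coprod L.subtype ∘ₗ X.subtype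
    have hv : ∀ x, v x ∈ LinearMap.range ε := by
      rintro ⟨⟨y, z⟩, hx⟩
      rw [← Submodule.ker_mkQ (LinearMap.range ε), LinearMap.mem_ker]
      change π (l y + z) = 0
      have hx' : q y + a₁ (c z) = 0 := hx
      rw [map_add, hl', ← hab', ← map_add, hx', map_zero]
    let E := LinearEquiv.ofInjective ε hε
    let u : F →ₗ[Λ] L := (ε ∘ₗ g).codRestrict L fun x => hs ⟨x, rfl⟩
    have hu : ∀ x, c (u x) = 0 := fun x => Subtype.ext (by
      change π (ε (g x)) = 0
      rw [← LinearMap.mem_ker, Submodule.ker_mkQ]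
      exact ⟨_, rfl⟩)
    refine ⟨ModuleCat.of Λ X, (LinearMap.inr Λ (Fin r → Λ) L ∘ₗ u).codRestrict X fun x => ?_,
      E.symm.toLinearMap ∘ₗ v.codRestrict _ hv, ?_, ?_, ?_⟩
    · simp [X, φ, hu]
    · exact inferInstanceAs (Module.Finite Λ X)
    · refine ExtVanishes.kernel_left X.injective_subtype hφ
        (LinearMap.exact_iff.2 (by simp [X])) hX₁ω ?_
      exact ((ExtVanishes.of_projective (X := Fin r → Λ)).prod_left hL).mono (by omega)
    · ext x
      change E.symm _ = g x
      rw [LinearEquiv.symm_apply_eq]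
      refine Subtype.ext ?_
      change l 0 + ε (g x) = ε (g x)
      rw [map_zero, zero_add]

end Gorenstein

/-! ### Indecomposable modules. -/

section Indecomposable

variable {Λ : Type u} [Ring Λ]

/-- Indecomposability in terms of complementary submodules. -/
def IsIndec (Λ : Type*) [Ring Λ] (N : Type*) [AddCommGroup N] [Module Λ N] : Prop :=
  ∀ p q : Submodule Λ N, IsCompl p q → p = ⊥ ∨ q = ⊥

theorem IsIndec.of_indecomposable {N : ModuleCat.{u} Λ} (hN : Indecomposable N) :
    IsIndec Λ N := by
  intro p q hpq
  have e : N ≅ ModuleCat.of Λ p ⊞ ModuleCat.of Λ q :=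
    (Submodule.prodEquivOfIsCompl p q hpq).symm.toModuleIso ≪≫
      (ModuleCat.biprodIsoProd (ModuleCat.of Λ p) (ModuleCat.of Λ q)).symm
  refine (hN.2 _ _ e).imp (fun h => ?_) fun h => ?_
  · exact (Submodule.subsingleton_iff_eq_bot (p := p)).1 (ModuleCat.subsingleton_of_isZero h)
  · exact (Submodule.subsingleton_iff_eq_bot (p := q)).1 (ModuleCat.subsingleton_of_isZero h)

theorem exists_prod_of_not_indecomposable {N : ModuleCat.{u} Λ} (hN : ¬ Indecomposable N)
    [Nontrivial N] : ∃ Y Z : ModuleCat.{u} Λ, Nontrivial Y ∧ Nontrivial Z ∧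
      Nonempty (N ≃ₗ[Λ] Y × Z) := by
  have h0 : ¬ Limits.IsZero N := fun h =>
    not_subsingleton N (ModuleCat.subsingleton_of_isZero h)
  simp only [Indecomposable, not_and, not_forall, not_or] at hN
  obtain ⟨Y, Z, e, hY, hZ⟩ := hN h0
  refine ⟨Y, Z, ?_, ?_, ⟨(e ≪≫ ModuleCat.biprodIsoProd Y Z).toLinearEquiv⟩⟩
  · by_contra h
    rw [not_nontrivial_iff_subsingleton] at h
    exact hY (ModuleCat.isZero_of_subsingleton Y)
  · by_contra h
    rw [not_nontrivial_iff_subsingleton] at h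
    exact hZ (ModuleCat.isZero_of_subsingleton Z)

theorem indecomposable_of_iso {N N' : ModuleCat.{u} Λ} (hN : Indecomposable N) (e : N ≅ N') :
    Indecomposable N' :=
  ⟨fun h => hN.1 (h.of_iso e), fun Y Z i => hN.2 Y Z (e ≪≫ i)⟩

end Indecomposable

/-! ### The Harada-Sai lemma. -/

section HaradaSai

variable {Λ : Type u} [Ring Λ]

section Length

variable {A B C : Type*} [AddCommGroup A] [Module Λ A] [AddCommGroup B] [Module Λ B]
  [AddCommGroup C] [Module Λ C]

theorem eq_of_le_of_length_le [IsNoetherian Λ A] [IsArtinian Λ A] {p q : Submodule Λ A}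
    (hpq : p ≤ q) (h : Module.length Λ q ≤ Module.length Λ p) : p = q := by
  by_contra hne
  have h1 : p.comap q.subtype ≠ ⊤ := fun h' =>
    hne (le_antisymm hpq (Submodule.comap_subtype_eq_top.1 h'))
  have h2 := Submodule.length_lt h1
  rw [(Submodule.comapSubtypeEquivOfLe hpq).length_eq] at h2
  exact absurd h h2.not_ge

/-- The restriction of `g` to the range of `f` has image the range of `g ∘ₗ f`; additivity of length
leaves length zero for its kernel. -/
theorem disjoint_range_ker [IsNoetherian Λ B] [IsArtinian Λ B] (f : A →ₗ[Λ] B) (g : B →ₗ[Λ] C)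
    (h : Module.length Λ (LinearMap.range f) ≤ Module.length Λ (LinearMap.range (g ∘ₗ f))) :
    Disjoint (LinearMap.range f) (LinearMap.ker g) := by
  let R := LinearMap.range f
  let u := g.domRestrict R
  have h1 := Module.length_eq_add_of_exact (LinearMap.ker u).subtype u.rangeRestrict
    (Submodule.injective_subtype _) u.surjective_rangeRestrict
    (LinearMap.exact_iff.2 (by rw [LinearMap.ker_rangeRestrict, Submodule.range_subtype]))
  have h2 : LinearMap.range u = LinearMap.range (g ∘ₗ f) := by
    rw [LinearMap.range_comp]
    exact LinearMap.range_domRestrict R g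
  rw [h2] at h1
  have hR : Module.length Λ R ≠ ⊤ := Module.length_ne_top
  have h3 : Module.length Λ (LinearMap.ker u) = 0 := by
    have h4 : Module.length Λ R ≤ Module.length Λ (LinearMap.range (g ∘ₗ f)) := h
    generalize Module.length Λ R = x at *
    generalize Module.length Λ (LinearMap.range (g ∘ₗ f)) = y at *
    generalize Module.length Λ (LinearMap.ker u) = z at *
    lift x to ℕ using hR
    have hy : y ≠ ⊤ := by rintro rfl; simp at h1
    have hz : z ≠ ⊤ := by rintro rfl; simp at h1
    lift y to ℕ using hy
    lift z to ℕ using hz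
    norm_cast at *
    omega
  rw [Module.length_eq_zero_iff] at h3
  rw [Submodule.disjoint_def]
  intro x hx hgx
  have : (⟨⟨x, hx⟩, hgx⟩ : LinearMap.ker u) = 0 := Subsingleton.elim _ _
  exact congrArg (fun y : LinearMap.ker u => ((y : R) : B)) this

theorem codisjoint_range_ker (f : A →ₗ[Λ] B) (g : B →ₗ[Λ] C)
    (h : LinearMap.range g ≤ LinearMap.range (g ∘ₗ f)) :
    Codisjoint (LinearMap.range f) (LinearMap.ker g) := by
  rw [codisjoint_iff, eq_top_iff]
  intro b _
  obtain ⟨a, ha⟩ := h ⟨b, rfl⟩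
  refine Submodule.mem_sup.2 ⟨f a, ⟨a, rfl⟩, b - f a, ?_, by simp⟩
  rw [LinearMap.mem_ker, map_sub, sub_eq_zero]
  exact ha.symm

end Length

variable {T : Type*} (N : T → ModuleCat.{u} Λ)

/-- Compositions of `n` nonisomorphisms between members of a family of modules. -/
inductive IsRadicalPath : ℕ → ∀ s t : T, (N s →ₗ[Λ] N t) → Prop
  | id (t : T) : IsRadicalPath 0 t t LinearMap.id
  | comp {n : ℕ} {r s t : T} {f : N r →ₗ[Λ] N s} (hf : IsRadicalPath n r s f)
      (g : N s →ₗ[Λ] N t) (hg : ¬ Function.Bijective g) : IsRadicalPath (n + 1) r t (g ∘ₗ f)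

variable {N}

theorem IsRadicalPath.exists_split {m n : ℕ} : ∀ {r t : T} {f : N r →ₗ[Λ] N t},
    IsRadicalPath N (m + n) r t f → ∃ (s : T) (g : N r →ₗ[Λ] N s) (h : N s →ₗ[Λ] N t),
      IsRadicalPath N m r s g ∧ IsRadicalPath N n s t h ∧ f = h ∘ₗ g := by
  induction n with
  | zero => exact fun {r t f} hf => ⟨t, f, LinearMap.id, hf, .id t, rfl⟩
  | succ n ih =>
    rintro r t f (_ | ⟨hf, g, hg⟩)
    obtain ⟨s, a, b, ha, hb, rfl⟩ := ih hf
    exact ⟨s, a, g ∘ₗ b, ha, hb.comp g hg, rfl⟩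

theorem IsRadicalPath.not_bijective {s t : T} {f : N s →ₗ[Λ] N t} (hf : IsRadicalPath N 1 s t f) :
    ¬ Function.Bijective f := by
  rcases hf with _ | ⟨hf, g, hg⟩
  cases hf
  exact hg

variable [∀ t, IsNoetherian Λ (N t)] [∀ t, IsArtinian Λ (N t)]

/-- The Harada-Sai lemma, in its inductive form. -/
theorem IsRadicalPath.length_range_le (hN : ∀ t, IsIndec Λ (N t)) {b : ℕ}
    (hb : ∀ t, Module.length Λ (N t) ≤ b) (m : ℕ) :
    ∀ {s t : T} {f : N s →ₗ[Λ] N t}, IsRadicalPath N (2 ^ m - 1) s t f → f ≠ 0 →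
      Module.length Λ (LinearMap.range f) + m ≤ b := by
  induction m with
  | zero =>
    intro s t f hf _
    rw [Nat.cast_zero, add_zero]
    exact (Module.length_le_of_injective _ (LinearMap.range f).injective_subtype).trans (hb t)
  | succ m ih =>
    intro s₁ s₄ f hf hf0
    -- The path is cut into two paths of length `2 ^ m - 1` around a single nonisomorphism `h`.
    have hm : 2 ^ (m + 1) - 1 = (2 ^ m - 1) + (1 + (2 ^ m - 1)) := by
      have := Nat.one_le_two_pow (n := m)
      rw [pow_succ]
      omega
    rw [hm] at hf
    obtain ⟨s₂, f₁, u, hf₁, hu, rfl⟩ := hf.exists_split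
    obtain ⟨s₃, h, f₃, hh, hf₃, rfl⟩ := hu.exists_split
    have hf₁0 : f₁ ≠ 0 := by rintro rfl; simp at hf0
    have hf₃0 : f₃ ≠ 0 := by rintro rfl; simp at hf0
    have hl₁ := ih hf₁ hf₁0
    have hl₃ := ih hf₃ hf₃0
    by_contra hlt
    -- If the bound fails, the total image is at least as long as the images of `f₁` and `f₃`. This
    -- splits the modules at both ends of `h`, and indecomposability makes `h` bijective.
    have key : ∀ x : ℕ∞, x + m ≤ b →
        x ≤ Module.length Λ (LinearMap.range ((f₃ ∘ₗ h) ∘ₗ f₁)) := by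
      intro x hx
      have hfin : Module.length Λ (LinearMap.range ((f₃ ∘ₗ h) ∘ₗ f₁)) ≠ ⊤ := Module.length_ne_top
      generalize Module.length Λ (LinearMap.range ((f₃ ∘ₗ h) ∘ₗ f₁)) = y at *
      lift y to ℕ using hfin
      have hxt : x ≠ ⊤ := by rintro rfl; simp at hx
      lift x to ℕ using hxt
      norm_cast at *
      omega
    have hr₃ : LinearMap.range ((f₃ ∘ₗ h) ∘ₗ f₁) = LinearMap.range f₃ :=
      eq_of_le_of_length_le (by rw [LinearMap.comp_assoc]; exact LinearMap.range_comp_le_range _ _)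
        (key _ hl₃)
    have hd₂ : Disjoint (LinearMap.range f₁) (LinearMap.ker (f₃ ∘ₗ h)) :=
      disjoint_range_ker _ _ (key _ hl₁)
    have hc₂ : Codisjoint (LinearMap.range f₁) (LinearMap.ker (f₃ ∘ₗ h)) :=
      codisjoint_range_ker _ _ ((LinearMap.range_comp_le_range _ _).trans hr₃.ge)
    have hd₃ : Disjoint (LinearMap.range (h ∘ₗ f₁)) (LinearMap.ker f₃) := by
      rw [Submodule.disjoint_def]
      rintro _ ⟨x, rfl⟩ hx
      have : f₁ x = 0 := Submodule.disjoint_def.1 hd₂ _ ⟨x, rfl⟩ hx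
      rw [LinearMap.comp_apply, this, map_zero]
    have hc₃ : Codisjoint (LinearMap.range (h ∘ₗ f₁)) (LinearMap.ker f₃) :=
      codisjoint_range_ker _ _ (by rw [← LinearMap.comp_assoc]; exact hr₃.ge)
    refine hh.not_bijective ⟨?_, ?_⟩
    · rcases hN s₂ _ _ ⟨hd₂, hc₂⟩ with h1 | h1
      · exact absurd (LinearMap.range_eq_bot.1 h1) hf₁0
      · exact Function.Injective.of_comp (f := f₃) (LinearMap.ker_eq_bot.1 h1)
    · rcases hN s₃ _ _ ⟨hd₃, hc₃⟩ with h1 | h1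
      · refine absurd ?_ hf0
        rw [LinearMap.comp_assoc, LinearMap.range_eq_bot.1 h1, LinearMap.comp_zero]
      · have h2 := hc₃.eq_top
        rw [h1, sup_bot_eq] at h2
        exact Function.Surjective.of_comp (g := f₁) (LinearMap.range_eq_top.1 h2)

/-- The Harada-Sai lemma. -/
theorem IsRadicalPath.eq_zero (hN : ∀ t, IsIndec Λ (N t)) {b : ℕ}
    (hb : ∀ t, Module.length Λ (N t) ≤ b) {s t : T} {f : N s →ₗ[Λ] N t}
    (hf : IsRadicalPath N (2 ^ b - 1) s t f) : f = 0 := by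
  by_contra h0
  have h1 := hf.length_range_le hN hb b h0
  have h2 : Module.length Λ (LinearMap.range f) ≤ 0 := by
    have h3 : Module.length Λ (LinearMap.range f) ≠ ⊤ := Module.length_ne_top
    generalize Module.length Λ (LinearMap.range f) = x at *
    lift x to ℕ using h3
    norm_cast at *
    omega
  rw [nonpos_iff_eq_zero, Module.length_eq_zero_iff, Submodule.subsingleton_iff_eq_bot] at h2
  exact h0 (LinearMap.range_eq_bot.1 h2)

end HaradaSai

/-! ### Decomposing a module by a maximal family of maps independent modulo the radical. -/

section Decomposition

variable {Λ : Type u} [Ring Λ] {T : Type u} (N : T → ModuleCat.{u} Λ)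
variable (M : Type u) [AddCommGroup M] [Module Λ M]

/-- The homomorphisms that factor through finite direct sums of members of a family. -/
def factorSubgroup (F : Type*) [AddCommGroup F] [Module Λ F] : AddSubgroup (F →ₗ[Λ] M) :=
  AddSubgroup.closure {f | ∃ (t : T) (a : F →ₗ[Λ] N t) (c : N t →ₗ[Λ] M), f = c ∘ₗ a}

/-- The radical homomorphisms from a member of a family of modules to a module. -/
def radicalSubgroup (t : T) : AddSubgroup (N t →ₗ[Λ] M) :=
  AddSubgroup.closure {f | ∃ (s : T) (a : N t →ₗ[Λ] N s) (c : N s →ₗ[Λ] M),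
    ¬ Function.Bijective a ∧ f = c ∘ₗ a}

/-- A set of homomorphisms from members of a family to `M` is independent modulo the radical. -/
def RadicalIndependent (B : Set (Σ t, (N t →ₗ[Λ] M))) : Prop :=
  ∀ (t : T) (s : Finset (Σ t, (N t →ₗ[Λ] M))), (s : Set (Σ t, (N t →ₗ[Λ] M))) ⊆ B →
    ∀ c : ∀ j : Σ t, (N t →ₗ[Λ] M), N t →ₗ[Λ] N j.1,
      ∑ j ∈ s, j.2 ∘ₗ c j ∈ radicalSubgroup N M t → ∀ j ∈ s, ¬ Function.Bijective (c j)

variable {N M}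

variable (M) in
/-- Precomposition as a homomorphism of groups. -/
def precompHom {F G : Type*} [AddCommGroup F] [Module Λ F] [AddCommGroup G] [Module Λ G]
    (a : F →ₗ[Λ] G) : (G →ₗ[Λ] M) →+ (F →ₗ[Λ] M) where
  toFun f := f ∘ₗ a
  map_zero' := LinearMap.zero_comp a
  map_add' f g := LinearMap.add_comp a g f

theorem comp_mem_factorSubgroup {F G : Type*} [AddCommGroup F] [Module Λ F] [AddCommGroup G]
    [Module Λ G] {f : G →ₗ[Λ] M} (hf : f ∈ factorSubgroup N M G) (a : F →ₗ[Λ] G) :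
    f ∘ₗ a ∈ factorSubgroup N M F := by
  have hle : factorSubgroup N M G ≤ (factorSubgroup N M F).comap (precompHom M a) := by
    refine (AddSubgroup.closure_le _).2 ?_
    rintro _ ⟨t, b, c, rfl⟩
    exact AddSubgroup.subset_closure ⟨t, b ∘ₗ a, c, rfl⟩
  exact hle hf

theorem comp_mem_radicalSubgroup {s t : T} {f : N t →ₗ[Λ] M} (hf : f ∈ radicalSubgroup N M t)
    {a : N s →ₗ[Λ] N t} (ha : Function.Bijective a) : f ∘ₗ a ∈ radicalSubgroup N M s := by
  have hle : radicalSubgroup N M t ≤ (radicalSubgroup N M s).comap (precompHom M a) := by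
    refine (AddSubgroup.closure_le _).2 ?_
    rintro _ ⟨r, b, c, hb, rfl⟩
    refine AddSubgroup.subset_closure ⟨r, b ∘ₗ a, c, fun h => hb ?_, rfl⟩
    exact (Function.Bijective.of_comp_iff b ha).1 h
  exact hle hf

variable (N M) in
theorem exists_maximal_radicalIndependent : ∃ B, Maximal (RadicalIndependent N M) B := by
  obtain ⟨B, _, hB⟩ := zorn_le_nonempty₀ {B | RadicalIndependent N M B}
    (fun C hC hch B₀ hB₀ => by
      refine ⟨⋃₀ C, fun t s hs c hc => ?_, fun B hB => Set.subset_sUnion_of_mem hB⟩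
      obtain ⟨B, hB, hsB⟩ := DirectedOn.exists_mem_subset_of_finite_of_subset_sUnion
        ⟨B₀, hB₀⟩ hch.directedOn s.finite_toSet hs
      exact hC hB t s hsB c hc) ∅ (fun t s hs c _ j hj => absurd (hs hj) (Set.notMem_empty j))
  exact ⟨B, hB⟩

-- A maximal independent family spans modulo the radical, as for vector spaces: adjoining a new map
-- creates a relation, which can be solved for that map.
open Classical in
theorem exists_sub_mem_radicalSubgroup {B : Set (Σ t, (N t →ₗ[Λ] M))}
    (hB : Maximal (RadicalIndependent N M) B) {t : T}
    (f : N t →ₗ[Λ] M) :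
    ∃ (s : Finset (Σ t, (N t →ₗ[Λ] M))) (c : ∀ j : Σ t, (N t →ₗ[Λ] M), N t →ₗ[Λ] N j.1),
      (s : Set (Σ t, (N t →ₗ[Λ] M))) ⊆ B ∧ f - ∑ j ∈ s, j.2 ∘ₗ c j ∈ radicalSubgroup N M t := by
  let j₀ : Σ t, (N t →ₗ[Λ] M) := ⟨t, f⟩
  by_cases hj₀ : j₀ ∈ B
  · refine ⟨{j₀}, Function.update (fun _ => 0) j₀ LinearMap.id, by simpa using hj₀, ?_⟩
    rw [Finset.sum_singleton, Function.update_self]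
    change f - f ∘ₗ LinearMap.id ∈ _
    rw [LinearMap.comp_id, sub_self]
    exact zero_mem _
  · have hnot : ¬ RadicalIndependent N M (insert j₀ B) := fun h =>
      hj₀ (hB.2 h (Set.subset_insert _ _) (Set.mem_insert _ _))
    simp only [RadicalIndependent, not_forall, not_not] at hnot
    obtain ⟨r, s, hs, c, hc, j, hj, hbij⟩ := hnot
    have hs' : ((s.erase j₀ : Finset _) : Set (Σ t, (N t →ₗ[Λ] M))) ⊆ B := by
      intro i hi
      rw [Finset.mem_coe, Finset.mem_erase] at hi
      exact (hs hi.2).resolve_left hi.1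
    have hj₀s : j₀ ∈ s := by
      by_contra h
      rw [Finset.erase_eq_of_notMem h] at hs'
      exact hB.1 r s hs' c hc j hj hbij
    rw [← Finset.add_sum_erase s _ hj₀s] at hc
    by_cases hb : Function.Bijective (c j₀)
    · let e := LinearEquiv.ofBijective (c j₀) hb
      let i : N t →ₗ[Λ] N r := e.symm.toLinearMap
      have hi : c j₀ ∘ₗ i = LinearMap.id := LinearMap.ext fun x => e.apply_symm_apply x
      refine ⟨s.erase j₀, fun j => -(c j ∘ₗ i), hs', ?_⟩
      have h1 := comp_mem_radicalSubgroup hc (a := i) e.symm.bijective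
      convert h1 using 1
      rw [LinearMap.add_comp, LinearMap.comp_assoc, hi, LinearMap.comp_id, sub_eq_add_neg,
        ← Finset.sum_neg_distrib]
      refine congrArg (f + ·) ((Finset.sum_congr rfl fun j _ => ?_).trans
        (map_sum (precompHom M i) _ _).symm)
      rw [LinearMap.comp_neg, neg_neg]
      rfl
    -- With a nonbijective coefficient the new term is itself radical, so what remains is a relation
    -- inside `B`, contradicting independence.
    · have h0 : j₀.2 ∘ₗ c j₀ ∈ radicalSubgroup N M r :=
        AddSubgroup.subset_closure ⟨_, c j₀, j₀.2, hb, rfl⟩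
      have h1 := hB.1 r _ hs' c ((AddSubgroup.add_mem_cancel_left _ h0).1 hc)
      by_cases hjj : j = j₀
      · subst hjj
        exact absurd hbij hb
      · exact absurd hbij (h1 j (Finset.mem_erase.2 ⟨hjj, hj⟩))

section DirectSum

variable {ι : Type*} [DecidableEq ι] {A : ι → Type*} [∀ i, AddCommGroup (A i)]
  [∀ i, Module Λ (A i)]

theorem directSum_eq_sum {s : Finset ι} {y : ⨁ i, A i} (hy : ∀ i ∉ s, y i = 0) :
    y = ∑ i ∈ s, DirectSum.lof Λ ι A i (y i) := by
  refine DFinsupp.ext fun j => ?_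
  rw [DFinsupp.finsetSum_apply]
  by_cases hj : j ∈ s
  · rw [Finset.sum_eq_single_of_mem j hj]
    · exact (DirectSum.lof_apply Λ j (y j)).symm
    · intro i _ hij
      exact DFinsupp.single_eq_of_ne hij.symm
  · rw [Finset.sum_eq_zero]
    · exact hy j hj
    · intro i hi
      exact DFinsupp.single_eq_of_ne (by rintro rfl; exact hj hi)

theorem exists_finset_of_finite {F : Type*} [AddCommGroup F] [Module Λ F] [Module.Finite Λ F]
    (g : F →ₗ[Λ] ⨁ i, A i) : ∃ s : Finset ι, ∀ x, ∀ i ∉ s, g x i = 0 := by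
  classical
  obtain ⟨n, x, hx⟩ := Module.Finite.exists_fin (R := Λ) (M := F)
  refine ⟨Finset.univ.biUnion fun k => (g (x k)).support, fun y i hi => ?_⟩
  have h1 : DirectSum.component Λ ι A i ∘ₗ g = 0 := by
    refine LinearMap.ext_on hx ?_
    rintro _ ⟨k, rfl⟩
    by_contra h
    exact hi (Finset.mem_biUnion.2 ⟨k, Finset.mem_univ k, DFinsupp.mem_support_iff.2 h⟩)
  exact LinearMap.congr_fun h1 y

end DirectSum

open Classical in
/-- The direct sum of the domains of a set of homomorphisms, mapped to `M`. -/
noncomputable def sumMap (B : Set (Σ t, (N t →ₗ[Λ] M))) : (⨁ j : B, N j.1.1) →ₗ[Λ] M :=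
  DirectSum.toModule Λ B M fun j => j.1.2

open Classical in
theorem sumMap_lof (B : Set (Σ t, (N t →ₗ[Λ] M))) (j : B) (x : N j.1.1) :
    sumMap B (DirectSum.lof Λ B (fun j : B => N j.1.1) j x) = j.1.2 x :=
  DirectSum.toModule_lof Λ _ _

section Lift

variable {B : Set (Σ t, (N t →ₗ[Λ] M))}

/-- The homomorphisms to `M` that lift along `sumMap B`. -/
noncomputable def liftSubgroup (B : Set (Σ t, (N t →ₗ[Λ] M))) (F : Type*) [AddCommGroup F]
    [Module Λ F] : AddSubgroup (F →ₗ[Λ] M) :=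
  AddMonoidHom.range (⟨⟨fun g : F →ₗ[Λ] ⨁ j : B, N j.1.1 => sumMap B ∘ₗ g, LinearMap.comp_zero _⟩,
    fun _ _ => LinearMap.comp_add _ _ _⟩ : (F →ₗ[Λ] ⨁ j : B, N j.1.1) →+ (F →ₗ[Λ] M))

theorem mem_liftSubgroup {F : Type*} [AddCommGroup F] [Module Λ F] {f : F →ₗ[Λ] M} :
    f ∈ liftSubgroup B F ↔ ∃ g : F →ₗ[Λ] ⨁ j : B, N j.1.1, sumMap B ∘ₗ g = f :=
  Iff.rfl

theorem comp_mem_liftSubgroup {F G : Type*} [AddCommGroup F] [Module Λ F] [AddCommGroup G]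
    [Module Λ G] {f : G →ₗ[Λ] M} (hf : f ∈ liftSubgroup B G) (a : F →ₗ[Λ] G) :
    f ∘ₗ a ∈ liftSubgroup B F := by
  obtain ⟨g, rfl⟩ := mem_liftSubgroup.1 hf
  exact mem_liftSubgroup.2 ⟨g ∘ₗ a, rfl⟩

open Classical in
/-- A homomorphism to `⨁ N j` killed by `sumMap B` has no isomorphisms among its components. -/
theorem component_not_bijective [∀ t, IsNoetherian Λ (N t)]
    (hB : RadicalIndependent N M B) {t : T} (g : N t →ₗ[Λ] ⨁ j : B, N j.1.1)
    (hg : sumMap B ∘ₗ g = 0) (j : B) :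
    ¬ Function.Bijective (DirectSum.component Λ B (fun j : B => N j.1.1) j ∘ₗ g) := by
  obtain ⟨s, hs⟩ := exists_finset_of_finite g
  let c : ∀ i : Σ t, (N t →ₗ[Λ] M), N t →ₗ[Λ] N i.1 := fun i =>
    if h : i ∈ B then DirectSum.component Λ B (fun j : B => N j.1.1) ⟨i, h⟩ ∘ₗ g else 0
  have hc : ∀ i : B, c i.1 = DirectSum.component Λ B (fun j : B => N j.1.1) i ∘ₗ g :=
    fun i => dif_pos i.2
  -- The index `j` is inserted so that independence speaks about it even when its component is zero.
  let s' : Finset (Σ t, (N t →ₗ[Λ] M)) := (insert j s).map (Function.Embedding.subtype _)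
  have hsum : ∑ i ∈ s', i.2 ∘ₗ c i = 0 := by
    rw [Finset.sum_map, ← hg]
    ext x
    rw [LinearMap.sum_apply, LinearMap.comp_apply,
      directSum_eq_sum (Λ := Λ) (s := insert j s) (y := g x)
        (fun i hi => hs x i fun h => hi (Finset.mem_insert_of_mem h)), map_sum]
    refine Finset.sum_congr rfl fun i _ => ?_
    rw [sumMap_lof]
    change i.1.2 (c i.1 x) = _
    rw [hc]
    rfl
  have hs'B : (s' : Set (Σ t, (N t →ₗ[Λ] M))) ⊆ B := by
    intro i hi
    obtain ⟨i, _, rfl⟩ := Finset.mem_map.1 (Finset.mem_coe.1 hi)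
    exact i.2
  rw [← hc]
  exact hB t s' hs'B c (hsum ▸ zero_mem _) j.1
    (Finset.mem_map.2 ⟨j, Finset.mem_insert_self _ _, rfl⟩)

variable [∀ t, IsNoetherian Λ (N t)] [∀ t, IsArtinian Λ (N t)]

-- Descending induction on the path length. Modulo the radical, `f` is a combination of members of
-- `B`, which lifts; a radical remainder composed with `h` is a sum of maps preceded by longer
-- paths. At length `2 ^ b - 1` the path is zero.
open Classical in
theorem comp_radicalPath_mem_liftSubgroup (hN : ∀ t, IsIndec Λ (N t)) {b : ℕ}
    (hb : ∀ t, Module.length Λ (N t) ≤ b) (hB : Maximal (RadicalIndependent N M) B) (k : ℕ) :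
    ∀ (n : ℕ), n + k = 2 ^ b - 1 → ∀ (s t : T) (h : N s →ₗ[Λ] N t), IsRadicalPath N n s t h →
      ∀ f : N t →ₗ[Λ] M, f ∘ₗ h ∈ liftSubgroup B (N s) := by
  induction k with
  | zero =>
    rintro n hn s t h hh f
    rw [add_zero] at hn
    subst hn
    rw [hh.eq_zero hN hb, LinearMap.comp_zero]
    exact zero_mem _
  | succ k ih =>
    intro n hn s t h hh f
    obtain ⟨u, c, hu, hc⟩ := exists_sub_mem_radicalSubgroup hB f
    have h1 : radicalSubgroup N M t ≤ (liftSubgroup B (N s)).comap (precompHom M h) := by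
      refine (AddSubgroup.closure_le _).2 ?_
      rintro _ ⟨r, a, c, ha, rfl⟩
      exact ih (n + 1) (by omega) s r _ (hh.comp a ha) c
    have h2 : ∑ j ∈ u, j.2 ∘ₗ c j ∈ liftSubgroup B (N t) := by
      refine sum_mem fun j hj => mem_liftSubgroup.2
        ⟨DirectSum.lof Λ B (fun j : B => N j.1.1) ⟨j, hu hj⟩ ∘ₗ c j, ?_⟩
      ext x
      exact sumMap_lof B ⟨j, hu hj⟩ (c j x)
    have h3 := add_mem (h1 hc) (comp_mem_liftSubgroup h2 h)
    change (f - _) ∘ₗ h + _ ∘ₗ h ∈ liftSubgroup B (N s) at h3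
    rwa [← LinearMap.add_comp, sub_add_cancel] at h3

theorem mem_liftSubgroup_of_mem_factorSubgroup (hN : ∀ t, IsIndec Λ (N t)) {b : ℕ}
    (hb : ∀ t, Module.length Λ (N t) ≤ b) (hB : Maximal (RadicalIndependent N M) B)
    {F : Type*} [AddCommGroup F] [Module Λ F] {f : F →ₗ[Λ] M} (hf : f ∈ factorSubgroup N M F) :
    f ∈ liftSubgroup B F := by
  refine (AddSubgroup.closure_le _).2 ?_ hf
  rintro _ ⟨t, a, c, rfl⟩
  have := comp_radicalPath_mem_liftSubgroup hN hb hB (2 ^ b - 1) 0 (zero_add _) t t _ (.id t) c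
  exact comp_mem_liftSubgroup this a

theorem sumMap_surjective (hN : ∀ t, IsIndec Λ (N t)) {b : ℕ}
    (hb : ∀ t, Module.length Λ (N t) ≤ b) (hB : Maximal (RadicalIndependent N M) B)
    (hM : ∀ (F : Type u) [AddCommGroup F] [Module Λ F] [Module.Finite Λ F] (f : F →ₗ[Λ] M),
      f ∈ factorSubgroup N M F) : Function.Surjective (sumMap B) := by
  intro x
  obtain ⟨g, hg⟩ := mem_liftSubgroup.1 (mem_liftSubgroup_of_mem_factorSubgroup hN hb hB
    (hM Λ (LinearMap.toSpanSingleton Λ M x)))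
  refine ⟨g 1, ?_⟩
  have := LinearMap.congr_fun hg 1
  simpa using this

-- Each application of `ρ` lengthens paths by one nonisomorphism, so a fixed element lies in the
-- span of images of arbitrarily long paths, which is eventually zero.
open Classical in
theorem eq_zero_of_radical_fixed (hN : ∀ t, IsIndec Λ (N t)) {b : ℕ}
    (hb : ∀ t, Module.length Λ (N t) ≤ b) (ρ : (⨁ j : B, N j.1.1) →ₗ[Λ] (⨁ j : B, N j.1.1))
    (hρ : ∀ i j : B, ¬ Function.Bijective (DirectSum.component Λ B (fun j : B => N j.1.1) j ∘ₗ
      ρ ∘ₗ DirectSum.lof Λ B (fun j : B => N j.1.1) i))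
    (x : ⨁ j : B, N j.1.1) (hx : ρ x = x) : x = 0 := by
  let L : ℕ → Submodule Λ (⨁ j : B, N j.1.1) := fun n => Submodule.span Λ
    {y | ∃ (i j : B) (h : N i.1.1 →ₗ[Λ] N j.1.1) (z : N i.1.1),
      IsRadicalPath N n i.1.1 j.1.1 h ∧ y = DirectSum.lof Λ B (fun j : B => N j.1.1) j (h z)}
  have hL0 : ∀ y, y ∈ L 0 := by
    intro y
    induction y using DirectSum.induction_on with
    | zero => exact zero_mem _
    | of i z => exact Submodule.subset_span ⟨i, i, LinearMap.id, z, .id _, rfl⟩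
    | add y z hy hz => exact add_mem hy hz
  have hstep : ∀ n, L n ≤ (L (n + 1)).comap ρ := by
    intro n
    refine Submodule.span_le.2 ?_
    rintro _ ⟨i, j, h, z, hh, rfl⟩
    rw [SetLike.mem_coe, Submodule.mem_comap]
    obtain ⟨s, hs⟩ := exists_finset_of_finite (ρ ∘ₗ DirectSum.lof Λ B (fun j : B => N j.1.1) j)
    have h1 := directSum_eq_sum (Λ := Λ) (hs (h z))
    rw [LinearMap.comp_apply] at h1
    rw [h1]
    exact sum_mem fun l _ => Submodule.subset_span ⟨i, l, _, z, hh.comp _ (hρ j l), rfl⟩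
  have hxL : ∀ n, x ∈ L n := by
    intro n
    induction n with
    | zero => exact hL0 x
    | succ n ih => exact hx ▸ hstep n ih
  have hbot : L (2 ^ b - 1) = ⊥ := by
    refine Submodule.span_eq_bot.2 ?_
    rintro _ ⟨i, j, h, z, hh, rfl⟩
    rw [hh.eq_zero hN hb, LinearMap.zero_apply, map_zero]
  have := hxL (2 ^ b - 1)
  rwa [hbot, Submodule.mem_bot] at this

open Classical in
theorem sumMap_injective (hN : ∀ t, IsIndec Λ (N t)) {b : ℕ}
    (hb : ∀ t, Module.length Λ (N t) ≤ b) (hB : Maximal (RadicalIndependent N M) B)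
    (hM : ∀ (F : Type u) [AddCommGroup F] [Module Λ F] [Module.Finite Λ F] (f : F →ₗ[Λ] M),
      f ∈ factorSubgroup N M F) : Function.Injective (sumMap B) := by
  refine (injective_iff_map_eq_zero _).2 fun x hx => ?_
  let s : Finset B := DFinsupp.support x
  let lof := DirectSum.lof Λ B (fun j : B => N j.1.1)
  let ι : (∀ j : s, N j.1.1.1) →ₗ[Λ] ⨁ j : B, N j.1.1 :=
    ∑ j : s, lof j.1 ∘ₗ LinearMap.proj j
  let π : (⨁ j : B, N j.1.1) →ₗ[Λ] (∀ j : s, N j.1.1.1) :=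
    LinearMap.pi fun j => DirectSum.component Λ B (fun j : B => N j.1.1) j.1
  have hιπ : ι (π x) = x := by
    have h1 := directSum_eq_sum (Λ := Λ) (s := s) (y := x)
      (fun i hi => DFinsupp.notMem_support_iff.1 hi)
    rw [← Finset.sum_coe_sort] at h1
    conv_rhs => rw [h1]
    rw [LinearMap.sum_apply]
    rfl
  let x₀ := π x
  -- On the finite subsum carrying `x`, the map to `M` factors through the quotient by `x₀`, a
  -- finitely generated module, and so lifts along `sumMap B`.
  obtain ⟨θ, hθ⟩ := mem_liftSubgroup.1 (mem_liftSubgroup_of_mem_factorSubgroup hN hb hB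
    (hM _ ((Submodule.span Λ {x₀}).liftQ (sumMap B ∘ₗ ι) (by
      rw [Submodule.span_singleton_le_iff_mem, LinearMap.mem_ker, LinearMap.comp_apply, hιπ, hx]))))
  -- The correction term kills `x₀`, so `ρ x = x`, while `sumMap B ∘ₗ ρ = 0` keeps isomorphisms out
  -- of its components.
  let ρ := (ι - θ ∘ₗ (Submodule.span Λ {x₀}).mkQ) ∘ₗ π
  have hφρ : sumMap B ∘ₗ ρ = 0 := by
    have : sumMap B ∘ₗ θ ∘ₗ (Submodule.span Λ {x₀}).mkQ = sumMap B ∘ₗ ι := by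
      rw [← LinearMap.comp_assoc, hθ, Submodule.liftQ_mkQ]
    rw [← LinearMap.comp_assoc, LinearMap.comp_sub, this, sub_self, LinearMap.zero_comp]
  refine eq_zero_of_radical_fixed hN hb ρ (fun i j => component_not_bijective hB.1 _ ?_ j) x ?_
  · rw [← LinearMap.comp_assoc, hφρ, LinearMap.zero_comp]
  · have h1 : (Submodule.span Λ {x₀}).mkQ (π x) = 0 := by
      rw [Submodule.mkQ_apply, Submodule.Quotient.mk_eq_zero]
      exact Submodule.mem_span_singleton_self _
    rw [LinearMap.comp_apply, LinearMap.sub_apply, LinearMap.comp_apply, h1, map_zero, sub_zero,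
      hιπ]

/-- A module whose homomorphisms from finitely generated modules factor through finite direct sums
of indecomposable modules of bounded length is a direct sum of such modules. -/
theorem exists_directSum_equiv (hN : ∀ t, IsIndec Λ (N t)) {b : ℕ}
    (hb : ∀ t, Module.length Λ (N t) ≤ b)
    (hM : ∀ (F : Type u) [AddCommGroup F] [Module Λ F] [Module.Finite Λ F] (f : F →ₗ[Λ] M),
      f ∈ factorSubgroup N M F) :
    ∃ (ι : Type u) (t : ι → T), Nonempty (M ≃ₗ[Λ] ⨁ i, N (t i)) := by
  obtain ⟨B, hB⟩ := exists_maximal_radicalIndependent N M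
  exact ⟨B, fun j => j.1.1, ⟨(LinearEquiv.ofBijective (sumMap B)
    ⟨sumMap_injective hN hb hB hM, sumMap_surjective hN hb hB hM⟩).symm⟩⟩

end Lift

end Decomposition

/-! ### Support modules, and the conclusion. -/

section Main

variable {Λ : Type u} [Ring Λ] {ω M : Type u} [AddCommGroup ω] [Module Λ ω] [AddCommGroup M]
  [Module Λ M]

variable (ω M) in
/-- The finitely generated indecomposable modules without extensions by `ω` that map nontrivially
to `M`. -/
def IsSupportModule (N : ModuleCat.{u} Λ) : Prop :=
  Module.Finite Λ N ∧ ExtVanishes Λ N ω 1 ∧ Indecomposable N ∧ ∃ f : N →ₗ[Λ] M, f ≠ 0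

variable (Λ ω M) in
/-- An index type for the support modules up to isomorphism. -/
def SupportIndex : Type u :=
  -- Quotients of `Λ^n` represent all isomorphism classes while keeping the index in `Type u`.
  {p : Σ n : ℕ, Submodule Λ (Fin n → Λ) //
    IsSupportModule ω M (ModuleCat.of Λ ((Fin p.1 → Λ) ⧸ p.2))}

/-- The support module of an index. -/
def supportModule (t : SupportIndex Λ ω M) : ModuleCat.{u} Λ :=
  ModuleCat.of Λ ((Fin t.1.1 → Λ) ⧸ t.1.2)

theorem isSupportModule (t : SupportIndex Λ ω M) : IsSupportModule ω M (supportModule t) := t.2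

theorem IsSupportModule.exists_equiv {N : ModuleCat.{u} Λ} (hN : IsSupportModule ω M N) :
    ∃ t : SupportIndex Λ ω M, Nonempty (N ≃ₗ[Λ] supportModule t) := by
  obtain ⟨hfin, hext, hind, f, hf⟩ := hN
  obtain ⟨n, q, hq⟩ := Module.Finite.exists_fin' Λ N
  let e := q.quotKerEquivOfSurjective hq
  refine ⟨⟨⟨n, LinearMap.ker q⟩, ?_, ?_, ?_, f ∘ₗ e.toLinearMap, fun h => hf ?_⟩, ⟨e.symm⟩⟩
  · exact inferInstanceAs (Module.Finite Λ ((Fin n → Λ) ⧸ LinearMap.ker q))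
  · exact hext.of_equiv_left e
  · exact indecomposable_of_iso hind e.symm.toModuleIso
  · ext x
    have := LinearMap.congr_fun h (e.symm x)
    simpa using this

/-- Homomorphisms to `M` from finitely generated modules without extensions by `ω` factor through
finite direct sums of support modules. -/
theorem mem_factorSubgroup_of_extVanishes [IsNoetherianRing Λ] [IsArtinianRing Λ] (n : ℕ) :
    ∀ (X : ModuleCat.{u} Λ), Module.Finite Λ X → ExtVanishes Λ X ω 1 →
      Module.length Λ X ≤ n → ∀ g : X →ₗ[Λ] M,
        g ∈ factorSubgroup (supportModule (Λ := Λ) (ω := ω) (M := M)) M X := by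
  induction n with
  | zero =>
    intro X _ _ hl g
    have : Subsingleton X := Module.length_eq_zero_iff.1 (nonpos_iff_eq_zero.1 hl)
    have hg : g = 0 := by
      ext x
      rw [Subsingleton.elim x 0, map_zero, map_zero]
    exact hg ▸ zero_mem _
  | succ n ih =>
    intro X hfin hX hl g
    -- Zero maps are set aside first, so that an indecomposable `X` met afterwards really maps
    -- nontrivially to `M` and the length bound will apply to it.
    by_cases hg : g = 0
    · exact hg ▸ zero_mem _
    by_cases hind : Indecomposable X
    · obtain ⟨t, ⟨e⟩⟩ := IsSupportModule.exists_equiv (N := X) (M := M) (ω := ω)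
        ⟨hfin, hX, hind, g, hg⟩
      refine AddSubgroup.subset_closure ⟨t, e.toLinearMap, g ∘ₗ e.symm.toLinearMap, ?_⟩
      ext x
      simp
    · have : Nontrivial X := by
        by_contra h
        rw [not_nontrivial_iff_subsingleton] at h
        refine hg (LinearMap.ext fun x => ?_)
        rw [Subsingleton.elim x 0, map_zero, map_zero]
      obtain ⟨Y, Z, hY, hZ, ⟨e⟩⟩ := exists_prod_of_not_indecomposable hind
      have hYX : LinearMap.fst Λ Y Z ∘ₗ e.toLinearMap ∘ₗ e.symm.toLinearMap ∘ₗ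
          LinearMap.inl Λ Y Z = LinearMap.id := by ext x; simp
      have hZX : LinearMap.snd Λ Y Z ∘ₗ e.toLinearMap ∘ₗ e.symm.toLinearMap ∘ₗ
          LinearMap.inr Λ Y Z = LinearMap.id := by ext x; simp
      have hYfin : Module.Finite Λ Y := Module.Finite.of_surjective
        (LinearMap.fst Λ Y Z ∘ₗ e.toLinearMap) fun y => ⟨e.symm (y, 0), by simp⟩
      have hZfin : Module.Finite Λ Z := Module.Finite.of_surjective
        (LinearMap.snd Λ Y Z ∘ₗ e.toLinearMap) fun z => ⟨e.symm (0, z), by simp⟩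
      have hlen : Module.length Λ X = Module.length Λ Y + Module.length Λ Z := by
        rw [e.length_eq, Module.length_prod]
      have hlY : Module.length Λ Y ≤ n ∧ Module.length Λ Z ≤ n := by
        have h1 : 0 < Module.length Λ Y := Module.length_pos
        have h2 : 0 < Module.length Λ Z := Module.length_pos
        have h3 : Module.length Λ Y ≠ ⊤ := Module.length_ne_top
        have h4 : Module.length Λ Z ≠ ⊤ := Module.length_ne_top
        rw [hlen] at hl
        generalize Module.length Λ Y = y at *
        generalize Module.length Λ Z = z at *
        lift y to ℕ using h3
        lift z to ℕ using h4
        norm_cast at *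
        omega
      have h1 := ih Y hYfin (hX.of_retract_left (e.symm.toLinearMap ∘ₗ LinearMap.inl Λ Y Z)
        (LinearMap.fst Λ Y Z ∘ₗ e.toLinearMap) hYX) hlY.1
        (g ∘ₗ e.symm.toLinearMap ∘ₗ LinearMap.inl Λ Y Z)
      have h2 := ih Z hZfin (hX.of_retract_left (e.symm.toLinearMap ∘ₗ LinearMap.inr Λ Y Z)
        (LinearMap.snd Λ Y Z ∘ₗ e.toLinearMap) hZX) hlY.2
        (g ∘ₗ e.symm.toLinearMap ∘ₗ LinearMap.inr Λ Y Z)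
      have h3 := add_mem (comp_mem_factorSubgroup h1 (LinearMap.fst Λ Y Z ∘ₗ e.toLinearMap))
        (comp_mem_factorSubgroup h2 (LinearMap.snd Λ Y Z ∘ₗ e.toLinearMap))
      convert h3 using 1
      ext x
      simp only [LinearMap.add_apply, LinearMap.comp_apply, LinearEquiv.coe_coe, ← map_add]
      simp

end Main

end CMArtin

theorem theorem7p4 {k : Type*} [CommRing k] [IsArtinianRing k]
    {Λ : Type u} [Ring Λ] [Algebra k Λ] [Module.Finite k Λ]
    (ω : Type u) [AddCommGroup ω] [Module Λ ω] [Module Λᵐᵒᵖ ω] [SMulCommClass Λ Λᵐᵒᵖ ω]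
    (hω : CMArtin.IsDualizing Λ ω)
    (M : Type u) [AddCommGroup M] [Module Λ M]
    (hM : CMArtin.IsGorensteinProjective Λ ω M)
    (hb : CMArtin.IsOfBoundedLength Λ (CMArtin.cmSupport Λ ω M)) :
    CMArtin.IsFullyDecomposable Λ ω M := by
  have : IsNoetherianRing Λ := isNoetherian_of_tower k inferInstance
  have : IsArtinianRing Λ := isArtinian_of_tower k inferInstance
  have hωfin := hω.finite
  let N := CMArtin.supportModule (Λ := Λ) (ω := ω) (M := M)
  have hN : ∀ t, CMArtin.IsIndecomposableCM Λ ω (N t) := fun t => by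
    have h := CMArtin.isSupportModule t
    have := h.1
    exact ⟨h.1, hω.isGorensteinProjective k h.2.1, h.2.2.1⟩
  have hfin : ∀ t, Module.Finite Λ (N t) := fun t => (hN t).1
  have hnoeth : ∀ t, IsNoetherian Λ (N t) := fun t => inferInstance
  have hart : ∀ t, IsArtinian Λ (N t) := fun t => inferInstance
  obtain ⟨b, hb⟩ := hb
  obtain ⟨n, hn⟩ := hω.inIInfty.2
  obtain ⟨ι, t, e⟩ := CMArtin.exists_directSum_equiv (N := N) (M := M) (b := b)
    (fun t => .of_indecomposable (hN t).2.2)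
    (fun t => hb _ ⟨hN t, (CMArtin.isSupportModule t).2.2.2⟩) (fun F _ _ hF f => by
      -- With `j = 0` the vanishing holds in all positive degrees; `t = n` steps suffice, `n`
      -- bounding the injective dimension of `ω`.
      obtain ⟨X, a, c, hX, hXω, rfl⟩ := CMArtin.exists_factorization hn (hω.extVanishes_self k) n 0
        (by omega) M F hM hF f
      have hl : Module.length Λ X ≠ ⊤ := Module.length_ne_top
      obtain ⟨l, hl⟩ := ENat.ne_top_iff_exists.1 hl
      exact CMArtin.comp_mem_factorSubgroup
        (CMArtin.mem_factorSubgroup_of_extVanishes l X hX hXω hl.symm.le c) a)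
  exact ⟨ι, fun i => N (t i), fun i => hN (t i), e⟩
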